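/- Let $n\ge 1$ and let $K\subset\mathbb R^n$ be a $C^2_+$ convex body, that is, a compact convex set with nonempty interior whose boundary is twice continuously differentiable with everywhere strictly positive Gauss curvature, and suppose that its centroid $\frac1{\mathrm{vol}_n(K)}\int_K x\,dx$ is $0$. Let $K^\circ=\{y:\langle y,x\rangle\le 1\ \text{for all } x\in K\}$ be its polar body. Fix $m,k\in\mathbb N\cup\{0\}$ and nonnegative integers $\vec i=(i_j)$ with $i_1+2i_2+\dots+(n-1)i_{n-1}=m$. For a $C^2_+$ convex body $L$ with $0$ in its interior let $N(x)$ be the outer unit normal at $x\in\partial L$, and let $H_j(x)$ be the $j$-th normalized elementary symmetric function of the principal curvatures of $\partial L$ at $x$ (so $H_{n-1}$ is the Gauss curvature). Let $\mu_{\vec i}=\mu_{\vec i,L}$ be the measure on $\partial L$ with $$d\mu_{\vec i}(x)=\prod_{j=1}^{n-1}\binom{n-1}{j}^{i_j}\,\langle x,N(x)\rangle^{m-k}\prod_{j=1}^{n-1}H_j(x)^{i_j}\,d\mathcal H^{n-1}(x),$$ and for $p\in\mathbb R$, $p\ne -n$, put $$\omega^p_{m,k,\vec i}(L)=\int_{\partial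 L}\frac{H_{n-1}(x)^{\frac p{n+p}}}{\langle x,N(x)\rangle^{\frac{n(p-1)}{n+p}}}\,d\mu_{\vec i}(x),\qquad \omega^\infty_{m,k,\vec i}(L)=\int_{\partial L}\frac{H_{n-1}(x)}{\langle x,N(x)\rangle^{n}}\,d\mu_{\vec i}(x).$$ Let $P_L=p_L\,\mu_{\vec i}$ and $Q_L=q_L\,\mu_{\vec i}$ with $p_L(x)=H_{n-1}(x)/\langle x,N(x)\rangle^n$ and $q_L(x)=\langle x,N(x)\rangle$, and let $D_{KL}(P_L\|Q_L)=\int_{\partial L} p_L\log\frac{p_L}{q_L}\,d\mu_{\vec i}$ and $D_{KL}(Q_L\|P_L)=\int_{\partial L} q_L\log\frac{q_L}{p_L}\,d\mu_{\vec i}$. Then the integrals defining $D_{KL}(P_K\|Q_K)$ and $D_{KL}(Q_{K^\circ}\|P_{K^\circ})$ converge absolutely, and (i) $$\lim_{p\to\infty}\left(\frac{\omega^p_{m,k,\vec i}(K)}{\omega^\infty_{m,k,\vec i}(K)}\right)^{n+p}=\exp\left(-\frac{n\,D_{KL}(P_K\|Q_K)}{\omega^\infty_{m,k,\vec i}(K)}\right);$$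 (ii) $$\lim_{p\to0}\left(\frac{\omega^p_{m,k,\vec i}(K^\circ)}{\omega^0_{m,k,\vec i}(K^\circ)}\right)^{\frac{n(n+p)}p}=\exp\left(-\frac{n\,D_{KL}(Q_{K^\circ}\|P_{K^\circ})}{\omega^0_{m,k,\vec i}(K^\circ)}\right).$$ -/

import Mathlib

open MeasureTheory Filter Topology
open scoped RealInnerProductSpace

noncomputable section

namespace WeightedAffineSurface

/-- Euclidean space `ℝⁿ`. -/
abbrev E (n : ℕ) : Type := EuclideanSpace ℝ (Fin n)

variable {n : ℕ}

/-- A convex body: a compact convex set with nonempty interior. -/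
def IsConvexBody (K : Set (E n)) : Prop :=
  Convex ℝ K ∧ IsCompact K ∧ (interior K).Nonempty

/-- The polar body `K° = {y : ⟪y, x⟫ ≤ 1 for all x ∈ K}`. -/
def polarBody (K : Set (E n)) : Set (E n) :=
  {y | ∀ x ∈ K, ⟪y, x⟫ ≤ 1}

/-- `u` is an outward unit normal vector of `K` at `x`. -/
def IsOuterUnitNormal (K : Set (E n)) (x u : E n) : Prop :=
  ‖u‖ = 1 ∧ ∀ y ∈ K, ⟪y - x, u⟫ ≤ 0

open Classical in
/-- The Gauss map `N_K`. At a boundary point of a convex body of class `C²` the outward unit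
normal is unique, so that the choice below is the unique one. -/
def gaussMap (K : Set (E n)) (x : E n) : E n :=
  if h : ∃ u, IsOuterUnitNormal K x u then h.choose else 0

/-- The boundary of the closed set `K` is of class `C²`: near each boundary point, `K` is the
sublevel set of a `C²` function with nonvanishing differential. -/
def HasC2Boundary (K : Set (E n)) : Prop :=
  ∀ x ∈ frontier K, ∃ φ : E n → ℝ,
    ContDiffAt ℝ 2 φ x ∧ fderiv ℝ φ x ≠ 0 ∧ ∀ᶠ y in 𝓝 x, (y ∈ K ↔ φ y ≤ 0)

/-- The tangent space of `∂K` at `x`, as the orthogonal complement of the normal. -/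
abbrev tangentSpace (K : Set (E n)) (x : E n) : Submodule ℝ (E n) :=
  (Submodule.span ℝ {gaussMap K x})ᗮ

/-- The Weingarten map: the differential at `x` of the Gauss map along `∂K`, as an endomorphism
of the tangent space. A derivative within `∂K` is determined on tangent vectors only, and it maps
them to tangent vectors, because the Gauss map takes values in the unit sphere; the orthogonal
projection just provides the codomain. -/
def weingarten (K : Set (E n)) (x : E n) :
    tangentSpace K x →ₗ[ℝ] tangentSpace K x :=
  (tangentSpace K x).orthogonalProjectionOnto.toLinearMap ∘ₗ
    (fderivWithin ℝ (gaussMap K) (frontier K) x).toLinearMap ∘ₗ (tangentSpace K x).subtype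

/-- The principal curvatures: the eigenvalues of the Weingarten map, with multiplicity. -/
def principalCurvatures (K : Set (E n)) (x : E n) : Multiset ℝ :=
  (weingarten K x).charpoly.roots

/-- `H_j`, the `j`-th normalized elementary symmetric function of the principal curvatures. -/
def symmCurv (K : Set (E n)) (j : ℕ) (x : E n) : ℝ :=
  ((n - 1).choose j : ℝ)⁻¹ * (principalCurvatures K x).esymm j

/-- The Gauss curvature `H_{n-1}`. -/
def gaussCurv (K : Set (E n)) (x : E n) : ℝ := symmCurv K (n - 1) x

/-- `K` is a convex body of class `C²₊`. -/
def IsC2PlusBody (K : Set (E n)) : Prop :=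
  IsConvexBody K ∧ HasC2Boundary K ∧ ∀ x ∈ frontier K, 0 < gaussCurv K x

/-- `⟪x, N(x)⟫`. -/
def supp (K : Set (E n)) (x : E n) : ℝ := ⟪x, gaussMap K x⟫

/-- The measure `μ_{m,k,i}` on `∂K`, with density
`∏ⱼ (n-1 choose j)^{i_j} · ⟪x, N(x)⟫^{m-k} · ∏ⱼ H_j(x)^{i_j}` with respect to the surface measure. -/
def weightMeasure (m k : ℕ) (i : ℕ → ℕ) (K : Set (E n)) : Measure (E n) :=
  ((μHE[n - 1] : Measure (E n)).restrict (frontier K)).withDensity fun x =>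
    ENNReal.ofReal ((∏ j ∈ Finset.Icc 1 (n - 1), ((n - 1).choose j : ℝ) ^ i j) *
      supp K x ^ ((m : ℤ) - (k : ℤ)) * ∏ j ∈ Finset.Icc 1 (n - 1), symmCurv K j x ^ i j)

/-- The weighted `L_p` affine surface area `ω^p_{m,k,i}(K)`. -/
def omega (m k : ℕ) (i : ℕ → ℕ) (p : ℝ) (K : Set (E n)) : ℝ :=
  ∫ x, gaussCurv K x ^ (p / (n + p)) / supp K x ^ (n * (p - 1) / (n + p))
    ∂(weightMeasure m k i K)

/-- The density `p_K = H_{n-1} / ⟪x, N(x)⟫ⁿ` of `P_K` with respect to `μ_{m,k,i}`. -/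
def densP (K : Set (E n)) (x : E n) : ℝ := gaussCurv K x / supp K x ^ n

/-- The density `q_K = ⟪x, N(x)⟫` of `Q_K` with respect to `μ_{m,k,i}`. -/
def densQ (K : Set (E n)) (x : E n) : ℝ := supp K x

/-- `ω^∞_{m,k,i}(K)`. -/
def omegaInfty (m k : ℕ) (i : ℕ → ℕ) (K : Set (E n)) : ℝ :=
  ∫ x, gaussCurv K x / supp K x ^ n ∂(weightMeasure m k i K)

/-- The integrand `p log (p / q)` of the relative entropy. -/
def klIntegrand {X : Type*} (p q : X → ℝ) (x : X) : ℝ := p x * Real.log (p x / q x)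

/-- The Kullback-Leibler divergence `D_KL(p μ ‖ q μ) = ∫ p log (p / q) dμ` (for measures that
need not be probability measures). -/
def klDivergence {X : Type*} [MeasurableSpace X] (μ : Measure X) (p q : X → ℝ) : ℝ :=
  ∫ x, klIntegrand p q x ∂μ

end WeightedAffineSurface

end

open WeightedAffineSurface

/-!
With `ε = n / (n + p)`, the integrand of `ω^p` is `p_L ^ (1 - ε) * q_L ^ ε`. So the two limits are
the derivatives, at the two endpoints of the interval `[0, 1]` of values of `ε`, of the logarithm of
`ε ↦ ∫ p_L ^ (1 - ε) * q_L ^ ε dμ`. Differentiation under the integral sign is allowed as soon as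
`μ` is finite and `p_L`, `q_L` are bounded between positive constants. For a `C²₊` body containing
the origin in its interior this is compactness of the boundary together with continuity and
positivity of the curvatures `H_j` and of `⟪x, N(x)⟫`.

The polar body is `C²₊` because its gauge is the support function `h` of `K`. By the Lagrange
multiplier rule and the inverse function theorem, positive Gauss curvature makes the point `X(y)` of
`K` with outer normal `y` a `C¹` function of `y`. Since `∇h = X`, the function `h` is `C²`, with
second derivative `D X`, whose kernel is the line of `y`; this is positivity of the curvature of the
boundary of the polar body.
-/

namespace WeightedAffineSurface

open scoped Gradient

section RenyiLimit

theorem tendsto_div_rpow_of_hasDerivAt_zero {F : ℝ → ℝ} {F' : ℝ} (c : ℝ)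
    (hF : HasDerivAt F F' 0) (h0 : 0 < F 0) :
    Tendsto (fun ε => (F ε / F 0) ^ (c / ε)) (𝓝[≠] 0) (𝓝 (Real.exp (c * (F' / F 0)))) := by
  have hlog : HasDerivAt (fun ε => Real.log (F ε / F 0)) (F' / F 0) 0 := by
    simpa [h0.ne'] using (hF.div_const (F 0)).log (by simp [h0.ne'])
  have hslope : Tendsto (fun ε => ε⁻¹ * Real.log (F ε / F 0)) (𝓝[≠] 0) (𝓝 (F' / F 0)) := by
    simpa [h0.ne'] using hlog.tendsto_slope_zero
  have hpos : ∀ᶠ ε in 𝓝[≠] 0, 0 < F ε :=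
    (hF.continuousAt.eventually (lt_mem_nhds h0)).filter_mono nhdsWithin_le_nhds
  refine ((Real.continuous_exp.tendsto _).comp (hslope.const_mul c)).congr' ?_
  filter_upwards [hpos] with ε hε
  rw [Function.comp_apply, Real.rpow_def_of_pos (div_pos hε h0)]
  ring_nf

variable {X : Type*} [MeasurableSpace X] {μ : Measure X} {f g : X → ℝ}

/-- `f` is almost everywhere bounded between two positive constants. The densities `p_L` and `q_L`
of a `C²₊` body have this property, which makes every integral below converge. -/
structure AEPosBounded (μ : Measure X) (f : X → ℝ) : Prop where
  aemeasurable : AEMeasurable f μ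
  exists_bounds : ∃ c C : ℝ, 0 < c ∧ ∀ᵐ x ∂μ, f x ∈ Set.Icc c C

namespace AEPosBounded

theorem ae_pos (hf : AEPosBounded μ f) : ∀ᵐ x ∂μ, 0 < f x := by
  obtain ⟨c, C, hc, hcC⟩ := hf.exists_bounds
  filter_upwards [hcC] with x hx using hc.trans_le hx.1

theorem integrable [IsFiniteMeasure μ] (hf : AEPosBounded μ f) : Integrable f μ := by
  obtain ⟨c, C, -, hcC⟩ := hf.exists_bounds
  exact Integrable.of_mem_Icc c C hf.aemeasurable hcC

theorem integral_pos [IsFiniteMeasure μ] [NeZero μ] (hf : AEPosBounded μ f) :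
    0 < ∫ x, f x ∂μ := by
  have hsupp : Function.support f =ᵐ[μ] Set.univ :=
    eventuallyEq_univ.mpr (hf.ae_pos.mono fun _ hx => hx.ne')
  rw [integral_pos_iff_support_of_nonneg_ae (hf.ae_pos.mono fun _ hx => hx.le) hf.integrable,
    measure_congr hsupp]
  exact Measure.measure_univ_pos.mpr (NeZero.ne μ)

theorem mono_ac {ν : Measure X} (hf : AEPosBounded μ f) (hν : ν ≪ μ) : AEPosBounded ν f where
  aemeasurable := hf.aemeasurable.mono_ac hν
  exists_bounds := hf.exists_bounds.imp fun _ => Exists.imp fun _ => And.imp_right (hν.ae_le ·)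

theorem pow (hf : AEPosBounded μ f) (N : ℕ) : AEPosBounded μ (fun x => f x ^ N) := by
  obtain ⟨c, C, hc, hcC⟩ := hf.exists_bounds
  refine ⟨hf.aemeasurable.pow_const N, c ^ N, C ^ N, by positivity, ?_⟩
  filter_upwards [hcC] with x hx
  exact ⟨pow_le_pow_left₀ hc.le hx.1 N, pow_le_pow_left₀ (hc.le.trans hx.1) hx.2 N⟩

theorem div (hf : AEPosBounded μ f) (hg : AEPosBounded μ g) :
    AEPosBounded μ (fun x => f x / g x) := by
  obtain ⟨c, C, hc, hcC⟩ := hf.exists_bounds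
  obtain ⟨d, D, hd, hdD⟩ := hg.exists_bounds
  refine ⟨hf.aemeasurable.div hg.aemeasurable, c / max D 1, C / d, by positivity, ?_⟩
  filter_upwards [hcC, hdD] with x hx hy
  exact ⟨div_le_div₀ (hc.le.trans hx.1) hx.1 (hd.trans_le hy.1) (hy.2.trans (le_max_left _ _)),
    div_le_div₀ (hc.le.trans (hx.1.trans hx.2)) hx.2 hd hy.1⟩

theorem exists_log_mem_Icc (hf : AEPosBounded μ f) :
    ∃ a b : ℝ, ∀ᵐ x ∂μ, Real.log (f x) ∈ Set.Icc a b := by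
  obtain ⟨c, C, hc, hcC⟩ := hf.exists_bounds
  refine ⟨Real.log c, Real.log C, hcC.mono fun x hx => ?_⟩
  exact ⟨Real.log_le_log hc hx.1, Real.log_le_log (hc.trans_le hx.1) hx.2⟩

theorem integrable_klIntegrand [IsFiniteMeasure μ] (hf : AEPosBounded μ f)
    (hg : AEPosBounded μ g) : Integrable (klIntegrand f g) μ := by
  obtain ⟨a, b, hab⟩ := (hf.div hg).exists_log_mem_Icc
  refine hf.integrable.mul_bdd (c := max |a| |b|)
    (hf.div hg).aemeasurable.log.aestronglyMeasurable (hab.mono fun x hx => ?_)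
  exact abs_le_max_abs_abs hx.1 hx.2

end AEPosBounded

theorem rpow_one_sub_mul_rpow {s t : ℝ} (ε : ℝ) (hs : 0 < s) (ht : 0 < t) :
    s ^ (1 - ε) * t ^ ε = s * Real.exp (ε * Real.log (t / s)) := by
  rw [mul_comm ε, ← Real.rpow_def_of_pos (div_pos ht hs), Real.rpow_sub hs, Real.rpow_one,
    Real.div_rpow ht.le hs.le]
  ring

/- The integrand is `f` times the exponential of `ε log (g / f)`, so the integral is a moment
generating function with respect to the measure `f μ`. -/
theorem hasDerivAt_integral_rpow_one_sub_mul_rpow [IsFiniteMeasure μ] (hf : AEPosBounded μ f)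
    (hg : AEPosBounded μ g) :
    HasDerivAt (fun ε : ℝ => ∫ x, f x ^ (1 - ε) * g x ^ ε ∂μ) (-klDivergence μ f g) 0 := by
  let P : Measure X := μ.withDensity fun x => ENNReal.ofReal (f x)
  let Y : X → ℝ := fun x => Real.log (g x / f x)
  have hfP : AEMeasurable (fun x => ENNReal.ofReal (f x)) μ := hf.aemeasurable.ennreal_ofReal
  have hPμ : P ≪ μ := withDensity_absolutelyContinuous _ _
  have : IsFiniteMeasure P := isFiniteMeasure_withDensity_ofReal hf.integrable.2
  have integral_P (F : X → ℝ) : ∫ x, F x ∂P = ∫ x, f x * F x ∂μ := by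
    rw [integral_withDensity_eq_integral_toReal_smul₀ hfP (by simp)]
    refine integral_congr_ae (hf.ae_pos.mono fun x hx => ?_)
    simp [hx.le]
  obtain ⟨a, b, hab⟩ := ((hg.div hf).mono_ac hPμ).exists_log_mem_Icc
  have hY : ProbabilityTheory.integrableExpSet Y P = Set.univ := Set.eq_univ_of_forall fun t =>
    ProbabilityTheory.integrable_exp_mul_of_mem_Icc
      ((hg.div hf).mono_ac hPμ).aemeasurable.log hab
  have hmgf := ProbabilityTheory.hasDerivAt_mgf (X := Y) (μ := P) (t := 0) (by simp [hY])
  convert hmgf using 1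
  · ext ε
    rw [ProbabilityTheory.mgf, integral_P]
    refine integral_congr_ae ?_
    filter_upwards [hf.ae_pos, hg.ae_pos] with x hx hy using rpow_one_sub_mul_rpow ε hx hy
  · rw [integral_P, klDivergence, ← integral_neg]
    congr 1 with x
    rw [klIntegrand, ← mul_neg, ← Real.log_inv, inv_div]
    simp [Y]

theorem tendsto_integral_rpow_one_sub_mul_rpow_div_rpow [IsFiniteMeasure μ] [NeZero μ]
    (hf : AEPosBounded μ f) (hg : AEPosBounded μ g) (c : ℝ) :
    Tendsto (fun ε : ℝ => ((∫ x, f x ^ (1 - ε) * g x ^ ε ∂μ) / ∫ x, f x ∂μ) ^ (c / ε)) (𝓝[≠] 0)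
      (𝓝 (Real.exp (-(c * klDivergence μ f g / ∫ x, f x ∂μ)))) := by
  have h := tendsto_div_rpow_of_hasDerivAt_zero c
    (hasDerivAt_integral_rpow_one_sub_mul_rpow hf hg) (by simpa using hf.integral_pos)
  simpa [neg_div, mul_div_assoc] using h

end RenyiLimit

section AffineSurfaceArea

variable {n m k : ℕ} {i : ℕ → ℕ} {L : Set (E n)}

theorem rpow_div_rpow_eq_mul_rpow {s t p : ℝ} (hs : 0 < s) (ht : 0 < t) (hp : (n : ℝ) + p ≠ 0) :
    s ^ (p / (n + p)) / t ^ (n * (p - 1) / (n + p)) =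
      (s / t ^ n) ^ (p / (n + p)) * t ^ (n / (n + p)) := by
  rw [Real.div_rpow hs.le (by positivity), ← Real.rpow_natCast t n, ← Real.rpow_mul ht.le,
    div_mul_eq_mul_div, div_eq_div_iff (by positivity) (by positivity), mul_assoc,
    ← Real.rpow_add ht]
  congr 2
  field

variable (hP : AEPosBounded (weightMeasure m k i L) (densP L))
  (hQ : AEPosBounded (weightMeasure m k i L) (densQ L))

include hP hQ

theorem omega_eq_integral_rpow_mul_rpow {p : ℝ} (hp : (n : ℝ) + p ≠ 0) :
    omega m k i p L =
      ∫ x, densP L x ^ (p / (n + p)) * densQ L x ^ ((n : ℝ) / (n + p)) ∂weightMeasure m k i L := by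
  refine integral_congr_ae ?_
  filter_upwards [hP.ae_pos, hQ.ae_pos] with x hPx (hQx : 0 < supp L x)
  have hH : 0 < gaussCurv L x := (div_pos_iff_of_pos_right (pow_pos hQx n)).mp hPx
  exact rpow_div_rpow_eq_mul_rpow hH hQx hp

theorem omega_zero_eq_integral_densQ (hn : 1 ≤ n) :
    omega m k i 0 L = ∫ x, densQ L x ∂weightMeasure m k i L := by
  have hn0 : (n : ℝ) ≠ 0 := by positivity
  rw [omega_eq_integral_rpow_mul_rpow hP hQ (by simpa using hn0)]
  simp [hn0]

variable [IsFiniteMeasure (weightMeasure m k i L)] [NeZero (weightMeasure m k i L)]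

theorem tendsto_omega_div_omegaInfty_rpow (hn : 1 ≤ n) :
    Tendsto (fun p : ℝ => (omega m k i p L / omegaInfty m k i L) ^ ((n : ℝ) + p)) atTop
      (𝓝 (Real.exp (-((n : ℝ) * klDivergence (weightMeasure m k i L) (densP L) (densQ L) /
        omegaInfty m k i L)))) := by
  have hn0 : (0 : ℝ) < n := by positivity
  have hε : Tendsto (fun p : ℝ => (n : ℝ) / (n + p)) atTop (𝓝[≠] 0) := by
    refine tendsto_nhdsWithin_iff.mpr
      ⟨(tendsto_atTop_add_const_left _ _ tendsto_id).const_div_atTop _, ?_⟩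
    filter_upwards [eventually_gt_atTop 0] with p hp
    exact (by positivity : (n : ℝ) / (n + p) ≠ 0)
  refine ((tendsto_integral_rpow_one_sub_mul_rpow_div_rpow hP hQ n).comp hε).congr' ?_
  filter_upwards [eventually_gt_atTop 0] with p hp
  have hnp : (n : ℝ) + p ≠ 0 := by positivity
  have hexp : 1 - (n : ℝ) / (n + p) = p / (n + p) := by field
  rw [Function.comp_apply, hexp, div_div_cancel₀ hn0.ne',
    omega_eq_integral_rpow_mul_rpow hP hQ hnp]
  rfl

theorem tendsto_omega_div_omega_zero_rpow (hn : 1 ≤ n) :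
    Tendsto (fun p : ℝ => (omega m k i p L / omega m k i 0 L) ^ ((n : ℝ) * (n + p) / p)) (𝓝[≠] 0)
      (𝓝 (Real.exp (-((n : ℝ) * klDivergence (weightMeasure m k i L) (densQ L) (densP L) /
        omega m k i 0 L)))) := by
  have hn0 : (n : ℝ) ≠ 0 := by positivity
  have hnp : ∀ᶠ p in 𝓝[≠] (0 : ℝ), (n : ℝ) + p ≠ 0 :=
    ((continuous_const_add (n : ℝ)).continuousAt.eventually_ne (by simpa using hn0)).filter_mono
      nhdsWithin_le_nhds
  have hε : Tendsto (fun p : ℝ => p / ((n : ℝ) + p)) (𝓝[≠] 0) (𝓝[≠] 0) := by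
    refine tendsto_nhdsWithin_iff.mpr ⟨?_, ?_⟩
    · have h : ContinuousAt (fun p : ℝ => p / ((n : ℝ) + p)) 0 :=
        continuousAt_id.div (continuousAt_const.add continuousAt_id) (by simpa using hn0)
      simpa using h.tendsto.mono_left nhdsWithin_le_nhds
    · filter_upwards [hnp, self_mem_nhdsWithin] with p hp hp0 using div_ne_zero hp0 hp
  rw [omega_zero_eq_integral_densQ hP hQ hn]
  refine ((tendsto_integral_rpow_one_sub_mul_rpow_div_rpow hQ hP n).comp hε).congr' ?_
  filter_upwards [hnp] with p hp
  have hexp : 1 - p / ((n : ℝ) + p) = n / (n + p) := by field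
  simp only [Function.comp_apply, hexp, div_div_eq_mul_div,
    omega_eq_integral_rpow_mul_rpow hP hQ hp, mul_comm]

end AffineSurfaceArea

section DefiningFunctions

section InnerProductSpace

variable {F : Type*} [NormedAddCommGroup F] [InnerProductSpace ℝ F] [CompleteSpace F]
  {φ : F → ℝ} {x : F}

theorem contDiffAt_gradient (hφ : ContDiffAt ℝ 2 φ x) : ContDiffAt ℝ 1 (∇ φ) x :=
  (InnerProductSpace.toDual ℝ F).symm.contDiff.contDiffAt.comp x (hφ.fderiv_right (by norm_num))

theorem differentiableAt_gradient (hφ : ContDiffAt ℝ 2 φ x) : DifferentiableAt ℝ (∇ φ) x :=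
  (contDiffAt_gradient hφ).differentiableAt one_ne_zero

theorem inner_fderiv_gradient (hφ : ContDiffAt ℝ 2 φ x) (v w : F) :
    ⟪fderiv ℝ (∇ φ) x v, w⟫ = fderiv ℝ (fderiv ℝ φ) x v w := by
  have h := ((InnerProductSpace.toDual ℝ F).hasFDerivAt (x := ∇ φ x)).comp x
    (differentiableAt_gradient hφ).hasFDerivAt
  rw [show InnerProductSpace.toDual ℝ F ∘ ∇ φ = fderiv ℝ φ from toDual_comp_gradient] at h
  rw [h.fderiv]
  rfl

theorem gradient_ne_zero (h : fderiv ℝ φ x ≠ 0) : ∇ φ x ≠ 0 := by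
  simpa [gradient] using h

theorem contDiffAt_normalize_gradient (hφ : ContDiffAt ℝ 2 φ x) (h : fderiv ℝ φ x ≠ 0) :
    ContDiffAt ℝ 1 (fun y => NormedSpace.normalize (∇ φ y)) x :=
  (((contDiffAt_gradient hφ).norm ℝ (gradient_ne_zero h)).inv
    (norm_ne_zero_iff.mpr (gradient_ne_zero h))).smul (contDiffAt_gradient hφ)

theorem inner_fderiv_normalize_gradient (hφ : ContDiffAt ℝ 2 φ x) (h : fderiv ℝ φ x ≠ 0) (v : F)
    {w : F} (hw : fderiv ℝ φ x w = 0) :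
    ⟪fderiv ℝ (fun y => NormedSpace.normalize (∇ φ y)) x v, w⟫ =
      ‖∇ φ x‖⁻¹ * fderiv ℝ (fderiv ℝ φ) x v w := by
  have hinv : DifferentiableAt ℝ (fun y => ‖∇ φ y‖⁻¹) x :=
    ((differentiableAt_gradient hφ).norm ℝ (gradient_ne_zero h)).inv
      (norm_ne_zero_iff.mpr (gradient_ne_zero h))
  have hderiv : HasFDerivAt (fun y => NormedSpace.normalize (∇ φ y)) _ x :=
    hinv.hasFDerivAt.smul (differentiableAt_gradient hφ).hasFDerivAt
  rw [hderiv.fderiv]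
  simp [inner_add_left, real_inner_smul_left, inner_fderiv_gradient hφ, hw]

theorem exists_curve_of_apply_eq_zero {φ' : F →L[ℝ] ℝ} (hφ : HasStrictFDerivAt φ φ' x)
    (hφ' : φ' ≠ 0) {v : F} (hv : φ' v = 0) :
    ∃ γ : ℝ → F, γ 0 = x ∧ HasDerivAt γ v 0 ∧ ∀ᶠ t in 𝓝 0, φ (γ t) = φ x := by
  have hsurj : φ'.range = ⊤ := LinearMap.range_eq_top.mpr
    (LinearMap.surjective_of_ne_zero fun h => hφ' (ContinuousLinearMap.coe_injective h))
  let ℓ : ℝ → φ'.ker := fun t => t • ⟨v, hv⟩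
  have hℓ : HasDerivAt ℓ ⟨v, hv⟩ 0 := by
    simpa using (hasDerivAt_id (0 : ℝ)).smul_const (⟨v, hv⟩ : φ'.ker)
  have hℓ0 : ℓ 0 = 0 := zero_smul _ _
  refine ⟨fun t => hφ.implicitFunction φ φ' hsurj (φ x) (ℓ t), ?_, ?_, ?_⟩
  · simp only [hℓ0, HasStrictFDerivAt.implicitFunction_apply_image]
  · have h := (hφ.to_implicitFunction hsurj).hasFDerivAt
    rw [← hℓ0] at h
    exact h.comp_hasDerivAt 0 hℓ
  · have htend : Tendsto (fun t => (φ x, ℓ t)) (𝓝 0) (𝓝 (φ x, 0)) := by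
      simpa only [hℓ0] using tendsto_const_nhds.prodMk_nhds hℓ.continuousAt.tendsto
    exact htend.eventually (hφ.map_implicitFunction_eq hsurj)

end InnerProductSpace

/-- `φ` is a defining function of `K` near `x`, as in the definition of `HasC2Boundary`: near `x`,
the set `K` is the sublevel set `φ ≤ 0` of a `C²` function with nonvanishing differential. The
point `x` need not lie on the boundary, so that the notion is open in `x`. -/
structure IsDefiningFunctionAt {n : ℕ} (K : Set (E n)) (φ : E n → ℝ) (x : E n) : Prop where
  contDiffAt : ContDiffAt ℝ 2 φ x
  fderiv_ne_zero : fderiv ℝ φ x ≠ 0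
  eventually_mem_iff : ∀ᶠ y in 𝓝 x, (y ∈ K ↔ φ y ≤ 0)

variable {n : ℕ} {K : Set (E n)} {φ : E n → ℝ} {x u v w : E n}

theorem isOuterUnitNormal_gaussMap (h : ∃ u, IsOuterUnitNormal K x u) :
    IsOuterUnitNormal K x (gaussMap K x) := by
  rw [gaussMap, dif_pos h]
  exact h.choose_spec

namespace IsDefiningFunctionAt

theorem eventually (hφ : IsDefiningFunctionAt K φ x) :
    ∀ᶠ y in 𝓝 x, IsDefiningFunctionAt K φ y := by
  have hne := (hφ.contDiffAt.continuousAt_fderiv two_ne_zero).eventually_ne hφ.fderiv_ne_zero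
  filter_upwards [hφ.contDiffAt.eventually (by simp), hne,
    hφ.eventually_mem_iff.eventually_nhds] with y h₁ h₂ h₃ using ⟨h₁, h₂, h₃⟩

theorem hasStrictFDerivAt (hφ : IsDefiningFunctionAt K φ x) :
    HasStrictFDerivAt φ (fderiv ℝ φ x) x :=
  hφ.contDiffAt.hasStrictFDerivAt two_ne_zero

theorem mem_frontier_iff (hφ : IsDefiningFunctionAt K φ x) : x ∈ frontier K ↔ φ x = 0 := by
  have hcont := hφ.contDiffAt.continuousAt
  constructor
  · intro hx
    by_contra hne
    rcases lt_or_gt_of_ne hne with h | h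
    · refine hx.2 (mem_interior_iff_mem_nhds.mpr ?_)
      filter_upwards [hφ.eventually_mem_iff, hcont.eventually (gt_mem_nhds h)] with y hy hlt
      exact hy.mpr hlt.le
    · refine mem_closure_iff_frequently.mp hx.1 ?_
      filter_upwards [hφ.eventually_mem_iff, hcont.eventually (lt_mem_nhds h)] with y hy hlt
      exact fun hyK => hlt.not_ge (hy.mp hyK)
  · intro h0
    have hxK : x ∈ K := hφ.eventually_mem_iff.self_of_nhds.mpr h0.le
    refine ⟨subset_closure hxK, fun hx_int => hφ.fderiv_ne_zero (IsLocalMax.fderiv_eq_zero ?_)⟩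
    filter_upwards [hφ.eventually_mem_iff, mem_interior_iff_mem_nhds.mp hx_int] with y hy hyK
    simpa [h0] using hy.mp hyK

theorem exists_curve (hφ : IsDefiningFunctionAt K φ x) (hx : x ∈ frontier K)
    (hv : fderiv ℝ φ x v = 0) :
    ∃ γ : ℝ → E n, γ 0 = x ∧ HasDerivAt γ v 0 ∧ ∀ᶠ t in 𝓝 0, γ t ∈ frontier K := by
  obtain ⟨γ, hγ0, hγ, hγφ⟩ :=
    exists_curve_of_apply_eq_zero hφ.hasStrictFDerivAt hφ.fderiv_ne_zero hv
  refine ⟨γ, hγ0, hγ, ?_⟩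
  have htend : Tendsto γ (𝓝 0) (𝓝 x) := hγ0 ▸ hγ.continuousAt.tendsto
  filter_upwards [hγφ, htend.eventually hφ.eventually] with t ht hφt
  rwa [hφt.mem_frontier_iff, ht, ← hφ.mem_frontier_iff]

theorem fderiv_sub_nonpos (hφ : IsDefiningFunctionAt K φ x) (hK : Convex ℝ K)
    (hx : x ∈ frontier K) {y : E n} (hy : y ∈ K) : fderiv ℝ φ x (y - x) ≤ 0 := by
  have hφx : φ x = 0 := hφ.mem_frontier_iff.mp hx
  have hxK : x ∈ K := hφ.eventually_mem_iff.self_of_nhds.mpr hφx.le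
  have hmax : IsLocalMaxOn φ K x := by
    filter_upwards [self_mem_nhdsWithin, hφ.eventually_mem_iff.filter_mono nhdsWithin_le_nhds]
      with y hyK hy
    simpa [hφx] using hy.mp hyK
  exact hmax.hasFDerivWithinAt_nonpos hφ.hasStrictFDerivAt.hasFDerivAt.hasFDerivWithinAt
    (sub_mem_posTangentConeAt_of_segment_subset (hK.segment_subset hxK hy))

theorem isOuterUnitNormal_normalize_gradient (hφ : IsDefiningFunctionAt K φ x) (hK : Convex ℝ K)
    (hx : x ∈ frontier K) : IsOuterUnitNormal K x (NormedSpace.normalize (∇ φ x)) := by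
  refine ⟨NormedSpace.norm_normalize_eq_one_iff.mpr (gradient_ne_zero hφ.fderiv_ne_zero),
    fun y hy => ?_⟩
  rw [NormedSpace.normalize, real_inner_smul_right, real_inner_comm, inner_gradient_left]
  exact mul_nonpos_of_nonneg_of_nonpos (by positivity) (hφ.fderiv_sub_nonpos hK hx hy)

/- Near `x`, the points beyond the supporting hyperplane `uᗮ` are not in `K`, so `φ` is positive
there. -/
theorem fderiv_nonneg_of_inner_pos (hφ : IsDefiningFunctionAt K φ x) (hx : x ∈ frontier K)
    (hu : IsOuterUnitNormal K x u) (hv : 0 < ⟪v, u⟫) : 0 ≤ fderiv ℝ φ x v := by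
  let s : Set (E n) := {y | 0 < ⟪y - x, u⟫}
  have hmin : IsLocalMinOn φ s x := by
    filter_upwards [self_mem_nhdsWithin, hφ.eventually_mem_iff.filter_mono nhdsWithin_le_nhds]
      with y hys hy
    rw [hφ.mem_frontier_iff.mp hx]
    exact (not_le.mp fun hle => hys.not_ge (hu.2 y (hy.mpr hle))).le
  have hmem : v ∈ posTangentConeAt s x := by
    refine mem_posTangentConeAt_of_frequently_mem (Eventually.frequently ?_)
    filter_upwards [self_mem_nhdsWithin] with t ht
    simpa [s, real_inner_smul_left] using mul_pos ht hv
  exact hmin.hasFDerivWithinAt_nonneg hφ.hasStrictFDerivAt.hasFDerivAt.hasFDerivWithinAt hmem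

theorem eq_normalize_gradient (hφ : IsDefiningFunctionAt K φ x) (hx : x ∈ frontier K)
    (hu : IsOuterUnitNormal K x u) : u = NormedSpace.normalize (∇ φ x) := by
  have hg := gradient_ne_zero hφ.fderiv_ne_zero
  set N := NormedSpace.normalize (∇ φ x) with hN
  have hN1 : ‖N‖ = 1 := NormedSpace.norm_normalize_eq_one_iff.mpr hg
  by_contra hne
  have hlt : ⟪N, u⟫ < 1 := (inner_lt_one_iff_real_of_norm_eq_one hN1 hu.1).mpr (Ne.symm hne)
  have hpos : 0 ≤ fderiv ℝ φ x (u - N) := hφ.fderiv_nonneg_of_inner_pos hx hu <| by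
    rw [inner_sub_left, inner_self_eq_one_of_norm_eq_one hu.1]
    linarith
  rw [← inner_gradient_left, ← NormedSpace.norm_smul_normalize (∇ φ x), ← hN,
    real_inner_smul_left, inner_sub_right, inner_self_eq_one_of_norm_eq_one hN1] at hpos
  nlinarith [norm_pos_iff.mpr hg]

section Convex

variable (hφ : IsDefiningFunctionAt K φ x) (hK : Convex ℝ K) (hx : x ∈ frontier K)

include hφ hK hx

theorem isOuterUnitNormal_gaussMap : IsOuterUnitNormal K x (gaussMap K x) :=
  WeightedAffineSurface.isOuterUnitNormal_gaussMap
    ⟨_, hφ.isOuterUnitNormal_normalize_gradient hK hx⟩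

theorem gaussMap_eq : gaussMap K x = NormedSpace.normalize (∇ φ x) :=
  hφ.eq_normalize_gradient hx (hφ.isOuterUnitNormal_gaussMap hK hx)

theorem mem_tangentSpace_iff : v ∈ tangentSpace K x ↔ fderiv ℝ φ x v = 0 := by
  have hnorm : ‖∇ φ x‖⁻¹ ≠ 0 := by simpa using gradient_ne_zero hφ.fderiv_ne_zero
  rw [Submodule.mem_orthogonal_singleton_iff_inner_right, hφ.gaussMap_eq hK hx,
    NormedSpace.normalize, real_inner_smul_left, inner_gradient_left, mul_eq_zero,
    or_iff_right hnorm]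

theorem fderiv_fderiv_nonneg (hv : fderiv ℝ φ x v = 0) : 0 ≤ fderiv ℝ (fderiv ℝ φ) x v v := by
  obtain ⟨γ, hγ0, hγ, hγK⟩ := hφ.exists_curve hx hv
  have hdiff : HasFDerivAt (fderiv ℝ φ) (fderiv ℝ (fderiv ℝ φ) x) x :=
    ((hφ.contDiffAt.fderiv_right (m := 1) (by norm_num)).differentiableAt one_ne_zero).hasFDerivAt
  have hslope := isBoundedBilinearMap_apply.continuous.continuousAt.tendsto.comp <|
    (hdiff.comp_hasDerivAt_of_eq 0 hγ hγ0.symm).tendsto_slope_zero_right.prodMk_nhds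
      hγ.tendsto_slope_zero_right
  have htend : Tendsto γ (𝓝 0) (𝓝 x) := hγ0 ▸ hγ.continuousAt.tendsto
  refine ge_of_tendsto hslope (Eventually.filter_mono nhdsWithin_le_nhds ?_)
  filter_upwards [hγK, htend.eventually hφ.eventually] with t ht hφt
  have hle₁ := hφ.fderiv_sub_nonpos hK hx
    (hφt.eventually_mem_iff.self_of_nhds.mpr (hφt.mem_frontier_iff.mp ht).le)
  have hle₂ := hφt.fderiv_sub_nonpos hK ht
    (hφ.eventually_mem_iff.self_of_nhds.mpr (hφ.mem_frontier_iff.mp hx).le)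
  rw [← neg_sub, map_neg] at hle₂
  have hmono : 0 ≤ (fderiv ℝ φ (γ t) - fderiv ℝ φ x) (γ t - x) := by
    rw [sub_apply]
    linarith
  simpa [hγ0, ← mul_assoc] using mul_nonneg (mul_self_nonneg t⁻¹) hmono

omit hx in
theorem gaussMap_eventuallyEq :
    gaussMap K =ᶠ[𝓝[frontier K] x] fun y => NormedSpace.normalize (∇ φ y) := by
  filter_upwards [self_mem_nhdsWithin, hφ.eventually.filter_mono nhdsWithin_le_nhds]
    with y hy hφy using hφy.gaussMap_eq hK hy

theorem hasFDerivWithinAt_gaussMap :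
    HasFDerivWithinAt (gaussMap K) (fderiv ℝ (fun y => NormedSpace.normalize (∇ φ y)) x)
      (frontier K) x :=
  ((contDiffAt_normalize_gradient hφ.contDiffAt hφ.fderiv_ne_zero).differentiableAt
    one_ne_zero).hasFDerivAt.hasFDerivWithinAt.congr_of_eventuallyEq
      (hφ.gaussMap_eventuallyEq hK) (hφ.gaussMap_eq hK hx)

theorem fderivWithin_gaussMap_apply (hv : fderiv ℝ φ x v = 0) :
    fderivWithin ℝ (gaussMap K) (frontier K) x v =
      fderiv ℝ (fun y => NormedSpace.normalize (∇ φ y)) x v := by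
  obtain ⟨γ, hγ0, hγ, hγK⟩ := hφ.exists_curve hx hv
  have h := hφ.hasFDerivWithinAt_gaussMap hK hx
  exact (h.differentiableWithinAt.hasFDerivWithinAt.comp_hasDerivAt_of_eq 0 hγ hγK hγ0.symm).unique
    (h.comp_hasDerivAt_of_eq 0 hγ hγK hγ0.symm)

theorem inner_weingarten (v w : tangentSpace K x) :
    ⟪weingarten K x v, w⟫ = ‖∇ φ x‖⁻¹ * fderiv ℝ (fderiv ℝ φ) x v w := by
  have hv := (hφ.mem_tangentSpace_iff hK hx).mp v.2
  have hw := (hφ.mem_tangentSpace_iff hK hx).mp w.2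
  rw [← inner_fderiv_normalize_gradient hφ.contDiffAt hφ.fderiv_ne_zero v hw,
    ← hφ.fderivWithin_gaussMap_apply hK hx hv]
  exact Submodule.inner_orthogonalProjectionOnto_eq_of_mem_right w _

theorem isSymmetric_weingarten : (weingarten K x).IsSymmetric := fun v w => by
  have hsymm : IsSymmSndFDerivAt ℝ φ x := hφ.contDiffAt.isSymmSndFDerivAt (by simp)
  rw [hφ.inner_weingarten hK hx, real_inner_comm, hφ.inner_weingarten hK hx, hsymm v w]

theorem finrank_tangentSpace : Module.finrank ℝ (tangentSpace K x) = n - 1 := by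
  have hN : gaussMap K x ≠ 0 :=
    norm_ne_zero_iff.mp ((hφ.isOuterUnitNormal_gaussMap hK hx).1 ▸ one_ne_zero)
  have h := Submodule.finrank_add_finrank_orthogonal (Submodule.span ℝ {gaussMap K x})
  rw [finrank_span_singleton hN, finrank_euclideanSpace_fin] at h
  exact Nat.eq_sub_of_add_eq' h

end Convex

end IsDefiningFunctionAt

end DefiningFunctions

section LinearAlgebra

theorem esymm_pos {R : Type*} [CommRing R] [LinearOrder R] [IsStrictOrderedRing R]
    {s : Multiset R} (hs : ∀ a ∈ s, 0 < a) {j : ℕ} (hj : j ≤ s.card) : 0 < s.esymm j := by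
  have hpos : ∀ b ∈ (s.powersetCard j).map Multiset.prod, 0 < b := by
    intro b hb
    obtain ⟨t, ht, rfl⟩ := Multiset.mem_map.mp hb
    exact Multiset.prod_pos fun a ha =>
      hs a (Multiset.mem_of_le (Multiset.mem_powersetCard.mp ht).1 ha)
  have hne : (s.powersetCard j).map Multiset.prod ≠ 0 := by
    rw [← Multiset.card_pos, Multiset.card_map, Multiset.card_powersetCard]
    exact Nat.choose_pos hj
  obtain ⟨b, hb⟩ := Multiset.exists_mem_of_ne_zero hne
  exact (hpos b hb).trans_le (Multiset.single_le_sum (fun a ha => (hpos a ha).le) b hb)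

theorem esymm_roots_charpoly {F V : Type*} [Field F] [AddCommGroup V] [Module F V]
    [FiniteDimensional F V] {T : V →ₗ[F] V} (hT : T.charpoly.Splits) {j : ℕ}
    (hj : j ≤ Module.finrank F V) :
    T.charpoly.roots.esymm j = (-1) ^ j * T.charpoly.coeff (Module.finrank F V - j) := by
  have hdeg := T.charpoly_natDegree
  rw [Polynomial.coeff_eq_esymm_roots_of_card hT.natDegree_eq_card_roots.symm
    (hdeg ▸ Nat.sub_le _ _), T.charpoly_monic.leadingCoeff, hdeg, Nat.sub_sub_self hj, one_mul,
    ← mul_assoc, ← mul_pow]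
  simp

theorem charpoly_comp_comm_of_le {R V W : Type*} [CommRing R] [Nontrivial R] [AddCommGroup V]
    [Module R V] [Module.Free R V] [Module.Finite R V] [AddCommGroup W] [Module R W]
    [Module.Free R W] [Module.Finite R W] (f : V →ₗ[R] W) (g : W →ₗ[R] V)
    (h : Module.finrank R V ≤ Module.finrank R W) :
    (f ∘ₗ g).charpoly =
      Polynomial.X ^ (Module.finrank R W - Module.finrank R V) * (g ∘ₗ f).charpoly := by
  let bV := Module.finBasis R V
  let bW := Module.finBasis R W
  rw [← LinearMap.charpoly_toMatrix _ bW, ← LinearMap.charpoly_toMatrix (g ∘ₗ f) bV,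
    LinearMap.toMatrix_comp bW bV bW, LinearMap.toMatrix_comp bV bW bV,
    Matrix.charpoly_mul_comm_of_le _ _ (by simpa using h)]
  simp

theorem continuous_charpoly_coeff {V : Type*} [NormedAddCommGroup V] [NormedSpace ℝ V]
    [FiniteDimensional ℝ V] (j : ℕ) :
    Continuous fun A : V →L[ℝ] V => A.toLinearMap.charpoly.coeff j := by
  let ι : (V →L[ℝ] V) →ₗ[ℝ] Module.End ℝ V := ContinuousLinearMap.coeLM ℝ
  let b := Module.finBasis ℝ (V →L[ℝ] V)
  have hpoly (A : V →L[ℝ] V) : A.toLinearMap.charpoly.coeff j =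
      MvPolynomial.eval (b.repr A) ((ι.polyCharpoly b).coeff j) :=
    (LinearMap.polyCharpoly_coeff_eval ι b A j).symm
  simp only [hpoly]
  exact (MvPolynomial.continuous_eval _).comp b.equivFunL.continuous

theorem starProjection_orthogonal_unit_singleton {F : Type*} [NormedAddCommGroup F]
    [InnerProductSpace ℝ F] {u : F} (hu : ‖u‖ = 1) :
    (Submodule.span ℝ {u})ᗮ.starProjection =
      ContinuousLinearMap.id ℝ F - (innerSL ℝ u).smulRight u := by
  ext z
  simp [Submodule.starProjection_unit_singleton ℝ hu]

end LinearAlgebra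

section PrincipalCurvatures

/-- At `x`, the bilinear form `D²φ` restricted to the tangent space `ker Dφ` of the level set of
`φ` has trivial kernel. -/
def HasNondegenerateTangentHessian {F : Type*} [NormedAddCommGroup F] [NormedSpace ℝ F]
    (φ : F → ℝ) (x : F) : Prop :=
  ∀ v, fderiv ℝ φ x v = 0 →
    (∀ w, fderiv ℝ φ x w = 0 → fderiv ℝ (fderiv ℝ φ) x v w = 0) → v = 0

namespace IsDefiningFunctionAt

variable {n : ℕ} {K : Set (E n)} {φ : E n → ℝ} {x : E n}
  (hφ : IsDefiningFunctionAt K φ x) (hK : Convex ℝ K) (hx : x ∈ frontier K)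

include hφ hK hx

theorem principalCurvatures_nonneg {a : ℝ} (ha : a ∈ principalCurvatures K x) : 0 ≤ a := by
  obtain ⟨v, hv⟩ := ((Module.End.hasEigenvalue_iff_isRoot_charpoly (weingarten K x) a).mpr
    (Polynomial.isRoot_of_mem_roots ha)).exists_hasEigenvector
  have hform : 0 ≤ ⟪weingarten K x v, v⟫ := by
    rw [hφ.inner_weingarten hK hx]
    exact mul_nonneg (by positivity)
      (hφ.fderiv_fderiv_nonneg hK hx ((hφ.mem_tangentSpace_iff hK hx).mp v.2))
  rw [hv.apply_eq_smul, real_inner_smul_left] at hform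
  exact nonneg_of_mul_nonneg_left hform (real_inner_self_pos.mpr hv.2)

theorem card_principalCurvatures : (principalCurvatures K x).card = n - 1 := by
  rw [principalCurvatures,
    ← (hφ.isSymmetric_weingarten hK hx).splits_charpoly.natDegree_eq_card_roots,
    LinearMap.charpoly_natDegree, hφ.finrank_tangentSpace hK hx]

theorem gaussCurv_eq_prod : gaussCurv K x = (principalCurvatures K x).prod := by
  rw [gaussCurv, symmCurv, Nat.choose_self, Nat.cast_one, inv_one, one_mul,
    ← hφ.card_principalCurvatures hK hx, Multiset.esymm, Multiset.powersetCard_self,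
    Multiset.map_singleton, Multiset.sum_singleton]

theorem gaussCurv_eq_det : gaussCurv K x = LinearMap.det (weingarten K x) := by
  rw [hφ.gaussCurv_eq_prod hK hx, principalCurvatures,
    ← Module.End.det_eq_prod_roots_charpoly_of_splits
      (hφ.isSymmetric_weingarten hK hx).splits_charpoly]

theorem symmCurv_pos (hcurv : 0 < gaussCurv K x) {j : ℕ} (hj : j ≤ n - 1) :
    0 < symmCurv K j x := by
  rw [hφ.gaussCurv_eq_prod hK hx] at hcurv
  have hpos : ∀ a ∈ principalCurvatures K x, 0 < a := fun a ha =>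
    (hφ.principalCurvatures_nonneg hK hx ha).lt_of_ne'
      fun h0 => hcurv.ne' (Multiset.prod_eq_zero (h0 ▸ ha))
  have hchoose : (0 : ℝ) < (n - 1).choose j := by exact_mod_cast Nat.choose_pos hj
  exact mul_pos (inv_pos.mpr hchoose)
    (esymm_pos hpos (hj.trans_eq (hφ.card_principalCurvatures hK hx).symm))

theorem weingarten_apply_eq_zero_iff (v : tangentSpace K x) :
    weingarten K x v = 0 ↔
      ∀ w, fderiv ℝ φ x w = 0 → fderiv ℝ (fderiv ℝ φ) x v w = 0 := by
  have hnorm : ‖∇ φ x‖⁻¹ ≠ 0 := by simpa using gradient_ne_zero hφ.fderiv_ne_zero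
  have hform (w : tangentSpace K x) :
      ⟪weingarten K x v, w⟫ = 0 ↔ fderiv ℝ (fderiv ℝ φ) x v w = 0 := by
    rw [hφ.inner_weingarten hK hx, mul_eq_zero, or_iff_right hnorm]
  refine ⟨fun h w hw => (hform ⟨w, (hφ.mem_tangentSpace_iff hK hx).mpr hw⟩).mp ?_, fun h => ?_⟩
  · rw [h, inner_zero_left]
  · exact inner_self_eq_zero.mp
      ((hform _).mpr (h _ ((hφ.mem_tangentSpace_iff hK hx).mp (weingarten K x v).2)))

theorem gaussCurv_pos_iff : 0 < gaussCurv K x ↔ HasNondegenerateTangentHessian φ x := by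
  have hnonneg : 0 ≤ gaussCurv K x := hφ.gaussCurv_eq_prod hK hx ▸
    Multiset.prod_nonneg fun a ha => hφ.principalCurvatures_nonneg hK hx ha
  have hker : LinearMap.det (weingarten K x) ≠ 0 ↔ ∀ v, weingarten K x v = 0 → v = 0 := by
    rw [← LinearMap.ker_eq_bot', Ne, LinearMap.det_eq_zero_iff_ker_ne_bot, not_not]
  rw [hnonneg.lt_iff_ne', hφ.gaussCurv_eq_det hK hx, hker]
  simp only [hφ.weingarten_apply_eq_zero_iff hK hx, HasNondegenerateTangentHessian,
    ← hφ.mem_tangentSpace_iff hK hx, Subtype.forall, Submodule.mk_eq_zero]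

/- `S ∘ π` and `π ∘ S` have the same characteristic polynomial up to a power of `X`; here `π` is
the projection to the tangent space and `S` the differential of the normal vector field. -/
theorem symmCurv_eq_charpoly_coeff {j : ℕ} (hj : j ≤ n - 1) :
    symmCurv K j x = ((n - 1).choose j : ℝ)⁻¹ * ((-1) ^ j *
      (fderiv ℝ (fun y => NormedSpace.normalize (∇ φ y)) x ∘L
        (tangentSpace K x).starProjection).toLinearMap.charpoly.coeff
          (n - 1 - j + (n - (n - 1)))) := by
  have hrank := hφ.finrank_tangentSpace hK hx
  let S := (fderivWithin ℝ (gaussMap K) (frontier K) x).toLinearMap ∘ₗ (tangentSpace K x).subtype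
  have hcomp : (fderiv ℝ (fun y => NormedSpace.normalize (∇ φ y)) x ∘L
      (tangentSpace K x).starProjection).toLinearMap =
        S ∘ₗ (tangentSpace K x).orthogonalProjectionOnto.toLinearMap := by
    ext1 z
    exact (hφ.fderivWithin_gaussMap_apply hK hx
      ((hφ.mem_tangentSpace_iff hK hx).mp (Subtype.property _))).symm
  rw [symmCurv, principalCurvatures,
    esymm_roots_charpoly (hφ.isSymmetric_weingarten hK hx).splits_charpoly (by rwa [hrank]), hcomp,
    charpoly_comp_comm_of_le _ _ (Submodule.finrank_le _), hrank, finrank_euclideanSpace_fin,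
    Polynomial.coeff_X_pow_mul]
  rfl

theorem continuousWithinAt_gaussMap : ContinuousWithinAt (gaussMap K) (frontier K) x :=
  (hφ.hasFDerivWithinAt_gaussMap hK hx).continuousWithinAt

theorem continuousWithinAt_starProjection_tangentSpace :
    ContinuousWithinAt (fun y => (tangentSpace K y).starProjection) (frontier K) x := by
  have hproj : Continuous fun u : E n =>
      ContinuousLinearMap.id ℝ (E n) - (innerSL ℝ u).smulRight u :=
    continuous_const.sub ((ContinuousLinearMap.smulRightL ℝ (E n) (E n)).continuous₂.comp
      ((innerSL ℝ).continuous.prodMk continuous_id))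
  refine (hproj.continuousAt.comp_continuousWithinAt
    (hφ.continuousWithinAt_gaussMap hK hx)).congr_of_eventuallyEq_of_mem ?_ hx
  filter_upwards [self_mem_nhdsWithin, hφ.eventually.filter_mono nhdsWithin_le_nhds] with y hy hφy
  exact starProjection_orthogonal_unit_singleton (hφy.isOuterUnitNormal_gaussMap hK hy).1

theorem continuousWithinAt_symmCurv {j : ℕ} (hj : j ≤ n - 1) :
    ContinuousWithinAt (symmCurv K j) (frontier K) x := by
  have hS : ContinuousWithinAt (fun y => fderiv ℝ (fun z => NormedSpace.normalize (∇ φ z)) y ∘L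
      (tangentSpace K y).starProjection) (frontier K) x :=
    ((contDiffAt_normalize_gradient hφ.contDiffAt hφ.fderiv_ne_zero).continuousAt_fderiv
      one_ne_zero).continuousWithinAt.clm_comp
        (hφ.continuousWithinAt_starProjection_tangentSpace hK hx)
  have hcoeff := (continuous_charpoly_coeff (V := E n) (n - 1 - j + (n - (n - 1)))).continuousAt
    |>.comp_continuousWithinAt hS
  refine ((hcoeff.const_mul ((-1) ^ j)).const_mul
    ((n - 1).choose j : ℝ)⁻¹).congr_of_eventuallyEq_of_mem ?_ hx
  filter_upwards [self_mem_nhdsWithin, hφ.eventually.filter_mono nhdsWithin_le_nhds]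
    with y hy hφy using hφy.symmCurv_eq_charpoly_coeff hK hy hj

end IsDefiningFunctionAt

end PrincipalCurvatures

section HausdorffMeasure

theorem exists_add_smul_mem_frontier {V : Type*} [NormedAddCommGroup V] [NormedSpace ℝ V]
    {S : Set V} (hS : Bornology.IsBounded S) {z u : V} (hz : z ∈ S) (hu : ‖u‖ = 1) :
    ∃ t : ℝ, z + t • u ∈ frontier S := by
  let ℓ : ℝ → V := fun t => z + t • u
  have hℓ : Isometry ℓ := Isometry.of_dist_eq fun t s => by
    simp [ℓ, dist_eq_norm, ← sub_smul, norm_smul, hu]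
  have hne : ℓ ⁻¹' S ≠ Set.univ := fun h =>
    NormedSpace.unbounded_univ ℝ ℝ (h ▸ hℓ.antilipschitz.isBounded_preimage hS)
  obtain ⟨t, ht⟩ := nonempty_frontier_iff.mpr ⟨⟨0, by simpa [ℓ] using hz⟩, hne⟩
  exact ⟨t, hℓ.continuous.frontier_preimage_subset S ht⟩

theorem hausdorffMeasure_lt_top_of_antilipschitzWith_restrict {X T : Type*} [EMetricSpace X]
    [MeasurableSpace X] [BorelSpace X] [NormedAddCommGroup T] [NormedSpace ℝ T]
    [FiniteDimensional ℝ T] [MeasurableSpace T] [BorelSpace T] {S : Set X} {f : X → T}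
    {C : NNReal} (hf : AntilipschitzWith C (S.domRestrict f)) (hS : Bornology.IsBounded (f '' S)) :
    μH[Module.finrank ℝ T] S < ⊤ := by
  have hd : (0 : ℝ) ≤ Module.finrank ℝ T := by positivity
  have huniv : μH[Module.finrank ℝ T] S = μH[Module.finrank ℝ T] (Set.univ : Set S) := by
    rw [← (isometry_subtype_coe (s := S)).hausdorffMeasure_image (Or.inl hd), Set.image_univ,
      Subtype.range_coe]
  have himage : S.domRestrict f '' Set.univ = f '' S := by
    rw [Set.image_univ, Set.range_domRestrict]
  rw [huniv]
  refine (hf.le_hausdorffMeasure_image hd Set.univ).trans_lt ?_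
  rw [himage]
  exact ENNReal.mul_lt_top (by finiteness) hS.measure_lt_top

/- The orthogonal projection along any direction maps the frontier onto the shadow of `S`. -/
theorem hausdorffMeasure_frontier_pos {V : Type*} [NormedAddCommGroup V] [InnerProductSpace ℝ V]
    [FiniteDimensional ℝ V] [MeasurableSpace V] [BorelSpace V] {S : Set V}
    (hS : Bornology.IsBounded S) (hne : (interior S).Nonempty) {d : ℕ}
    (hd : Module.finrank ℝ V = d + 1) : 0 < μH[d] (frontier S) := by
  have : Nontrivial V := Module.nontrivial_of_finrank_pos (R := ℝ) (hd ▸ d.succ_pos)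
  obtain ⟨u, hu⟩ := exists_norm_eq V zero_le_one
  let T := (Submodule.span ℝ {u})ᗮ
  let π := T.orthogonalProjectionOnto
  have hπu : π u = 0 := T.orthogonalProjectionOnto_eq_zero_iff.mpr
    (Submodule.le_orthogonal_orthogonal _ (Submodule.mem_span_singleton_self u))
  have hT : Module.finrank ℝ T = d := by
    have : Fact (Module.finrank ℝ V = d + 1) := ⟨hd⟩
    exact Submodule.finrank_orthogonal_span_singleton (norm_ne_zero_iff.mp (hu ▸ one_ne_zero))
  have hshadow : π '' interior S ⊆ π '' frontier S := by
    rintro _ ⟨z, hz, rfl⟩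
    obtain ⟨t, ht⟩ := exists_add_smul_mem_frontier hS (interior_subset hz) hu
    exact ⟨z + t • u, ht, by rw [map_add, map_smul, hπu, smul_zero, add_zero]⟩
  have hsurj : Function.Surjective π := fun w =>
    ⟨w, T.orthogonalProjectionOnto_mem_subspace_eq_self w⟩
  have hopen : IsOpen (π '' interior S) :=
    π.isOpenMap hsurj _ isOpen_interior
  have hpos : 0 < μH[Module.finrank ℝ T] (π '' interior S) :=
    hopen.measure_pos _ (hne.image π)
  rw [hT] at hpos
  exact hpos.trans_le ((measure_mono hshadow).trans
    (hausdorffMeasure_orthogonalProjectionOnto_le T d _ (by positivity)))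

end HausdorffMeasure

section SurfaceMeasure

variable {n : ℕ} {K : Set (E n)} {x y z u v w : E n}

theorem exists_add_smul_mem_of_mem_interior {V : Type*} [NormedAddCommGroup V] [NormedSpace ℝ V]
    {S : Set V} {a : V} (ha : a ∈ interior S) (v : V) : ∃ t : ℝ, 0 < t ∧ a + t • v ∈ S := by
  have htend : Tendsto (fun t : ℝ => a + t • v) (𝓝[>] 0) (𝓝 a) :=
    tendsto_nhdsWithin_of_tendsto_nhds (Continuous.tendsto' (by fun_prop) 0 a (by simp))
  exact (eventually_mem_nhdsWithin.and
    (htend.eventually (mem_interior_iff_mem_nhds.mp ha))).exists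

theorem IsOuterUnitNormal.inner_pos (hu : IsOuterUnitNormal K x u) (h0 : (0 : E n) ∈ interior K) :
    0 < ⟪x, u⟫ := by
  obtain ⟨t, ht, htK⟩ := exists_add_smul_mem_of_mem_interior h0 u
  rw [zero_add] at htK
  have h := hu.2 _ htK
  rw [inner_sub_left, real_inner_smul_left, inner_self_eq_one_of_norm_eq_one hu.1] at h
  linarith

theorem IsOuterUnitNormal.inner_sub_le (hu : IsOuterUnitNormal K x u) (hy : y ∈ K) (v : E n) :
    ⟪v, y - x⟫ ≤ ‖v - u‖ * ‖y - x‖ := by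
  have h := real_inner_le_norm (v - u) (y - x)
  rw [inner_sub_left, real_inner_comm (y - x) u] at h
  linarith [hu.2 y hy]

theorem norm_le_two_mul_norm_orthogonalProjectionOnto {F : Type*} [NormedAddCommGroup F]
    [InnerProductSpace ℝ F] {u w : F} (hu : ‖u‖ = 1) (hw : |⟪u, w⟫| ≤ 1 / 2 * ‖w‖) :
    ‖w‖ ≤ 2 * ‖(Submodule.span ℝ {u})ᗮ.orthogonalProjectionOnto w‖ := by
  have hsplit := (Submodule.span ℝ {u}).starProjection_add_starProjection_orthogonal w
  have hline : ‖(Submodule.span ℝ {u}).starProjection w‖ ≤ 1 / 2 * ‖w‖ := by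
    rwa [Submodule.starProjection_unit_singleton ℝ hu, norm_smul, hu, mul_one]
  have htri := norm_add_le ((Submodule.span ℝ {u}).starProjection w)
    ((Submodule.span ℝ {u})ᗮ.starProjection w)
  rw [hsplit] at htri
  have hcoe : ‖(Submodule.span ℝ {u})ᗮ.starProjection w‖ =
    ‖(Submodule.span ℝ {u})ᗮ.orthogonalProjectionOnto w‖ := rfl
  linarith

namespace HasC2Boundary

variable (hC : HasC2Boundary K)

include hC

theorem exists_isDefiningFunctionAt (hx : x ∈ frontier K) : ∃ φ, IsDefiningFunctionAt K φ x := by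
  obtain ⟨φ, h₁, h₂, h₃⟩ := hC x hx
  exact ⟨φ, h₁, h₂, h₃⟩

theorem frontier_subset : frontier K ⊆ K := fun x hx => by
  obtain ⟨φ, hφ⟩ := hC.exists_isDefiningFunctionAt hx
  exact hφ.eventually_mem_iff.self_of_nhds.mpr (hφ.mem_frontier_iff.mp hx).le

variable (hK : Convex ℝ K)

include hK

theorem isOuterUnitNormal_gaussMap (hx : x ∈ frontier K) :
    IsOuterUnitNormal K x (gaussMap K x) := by
  obtain ⟨φ, hφ⟩ := hC.exists_isDefiningFunctionAt hx
  exact hφ.isOuterUnitNormal_gaussMap hK hx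

theorem continuousOn_gaussMap : ContinuousOn (gaussMap K) (frontier K) := fun x hx => by
  obtain ⟨φ, hφ⟩ := hC.exists_isDefiningFunctionAt hx
  exact hφ.continuousWithinAt_gaussMap hK hx

theorem continuousOn_supp : ContinuousOn (supp K) (frontier K) :=
  continuousOn_id.inner (hC.continuousOn_gaussMap hK)

theorem continuousOn_symmCurv {j : ℕ} (hj : j ≤ n - 1) :
    ContinuousOn (symmCurv K j) (frontier K) := fun x hx => by
  obtain ⟨φ, hφ⟩ := hC.exists_isDefiningFunctionAt hx
  exact hφ.continuousWithinAt_symmCurv hK hx hj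

theorem exists_nhdsWithin_antilipschitzWith (hx : x ∈ frontier K) :
    ∃ S ∈ 𝓝[frontier K] x, S ⊆ frontier K ∧
      AntilipschitzWith 2 (S.domRestrict (tangentSpace K x).orthogonalProjectionOnto) := by
  let S := {y | ‖gaussMap K x - gaussMap K y‖ < 1 / 2} ∩ frontier K
  have hS : S ∈ 𝓝[frontier K] x := by
    refine inter_mem ?_ self_mem_nhdsWithin
    filter_upwards [(hC.continuousOn_gaussMap hK x hx).eventually
      (Metric.ball_mem_nhds (gaussMap K x) one_half_pos)] with y hy
    rwa [← dist_eq_norm']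
  have hinner {y z : E n} (hy : y ∈ S) (hz : z ∈ S) :
      ⟪gaussMap K x, z - y⟫ ≤ 1 / 2 * ‖z - y‖ :=
    ((hC.isOuterUnitNormal_gaussMap hK hy.2).inner_sub_le (hC.frontier_subset hz.2) _).trans
      (by gcongr; exact hy.1.le)
  refine ⟨S, hS, Set.inter_subset_right, AntilipschitzWith.of_le_mul_dist fun y z => ?_⟩
  rw [Subtype.dist_eq, dist_eq_norm, dist_eq_norm, Set.domRestrict_apply, Set.domRestrict_apply,
    ← map_sub]
  refine norm_le_two_mul_norm_orthogonalProjectionOnto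
    (hC.isOuterUnitNormal_gaussMap hK hx).1 (abs_le'.mpr ⟨hinner z.2 y.2, ?_⟩)
  rw [← inner_neg_right, neg_sub, norm_sub_rev]
  exact hinner y.2 z.2

theorem hausdorffMeasure_frontier_lt_top (hbdd : Bornology.IsBounded K) :
    μH[(n - 1 : ℕ)] (frontier K) < ⊤ := by
  have hcompact : IsCompact (frontier K) :=
    Metric.isCompact_of_isClosed_isBounded isClosed_frontier (hbdd.subset hC.frontier_subset)
  refine hcompact.measure_lt_top_of_nhdsWithin fun x hx => ?_
  obtain ⟨φ, hφ⟩ := hC.exists_isDefiningFunctionAt hx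
  obtain ⟨S, hS, hSK, hanti⟩ := hC.exists_nhdsWithin_antilipschitzWith hK hx
  refine ⟨S, hS, ?_⟩
  rw [← hφ.finrank_tangentSpace hK hx]
  exact hausdorffMeasure_lt_top_of_antilipschitzWith_restrict hanti
    ((tangentSpace K x).orthogonalProjectionOnto.lipschitz.isBounded_image
      (hcompact.isBounded.subset hSK))

end HasC2Boundary

theorem AEPosBounded.of_continuousOn {X : Type*} [TopologicalSpace X] [MeasurableSpace X]
    [OpensMeasurableSpace X] {μ : Measure X} {S : Set X} {f : X → ℝ} (hS : IsCompact S)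
    (hm : MeasurableSet S) (hf : ContinuousOn f S) (hpos : ∀ x ∈ S, 0 < f x) :
    AEPosBounded (μ.restrict S) f := by
  refine ⟨hf.aemeasurable hm, ?_⟩
  rcases S.eq_empty_or_nonempty with rfl | hne
  · exact ⟨1, 1, one_pos, by simp⟩
  obtain ⟨a, ha, hamin⟩ := hS.exists_isMinOn hne hf
  obtain ⟨b, -, hbmax⟩ := hS.exists_isMaxOn hne hf
  exact ⟨f a, f b, hpos a ha, ae_restrict_of_forall_mem hm fun x hx => ⟨hamin hx, hbmax hx⟩⟩

theorem weightMeasure_absolutelyContinuous {m k : ℕ} {i : ℕ → ℕ} :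
    weightMeasure m k i K ≪ (μHE[n - 1] : Measure (E n)).restrict (frontier K) :=
  withDensity_absolutelyContinuous _ _

namespace IsC2PlusBody

variable (hK : IsC2PlusBody K)

include hK

theorem euclideanHausdorffMeasure_frontier_lt_top :
    (μHE[n - 1] : Measure (E n)) (frontier K) < ⊤ := by
  rw [Measure.euclideanHausdorffMeasure_def, Measure.smul_apply, ENNReal.smul_def, smul_eq_mul]
  exact ENNReal.mul_lt_top ENNReal.coe_lt_top
    (hK.2.1.hausdorffMeasure_frontier_lt_top hK.1.1 hK.1.2.1.isBounded)

theorem euclideanHausdorffMeasure_frontier_pos (hn : 1 ≤ n) :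
    0 < (μHE[n - 1] : Measure (E n)) (frontier K) := by
  rw [Measure.euclideanHausdorffMeasure_def, Measure.smul_apply, ENNReal.smul_def, smul_eq_mul]
  refine ENNReal.mul_pos
    (by simpa using Measure.addHaarScalarFactor_volume_hausdorffMeasure_ne_zero (n - 1))
    (hausdorffMeasure_frontier_pos hK.1.2.1.isBounded hK.1.2.2 ?_).ne'
  rw [finrank_euclideanSpace_fin, Nat.sub_add_cancel hn]

theorem symmCurv_pos (hx : x ∈ frontier K) {j : ℕ} (hj : j ≤ n - 1) : 0 < symmCurv K j x := by
  obtain ⟨φ, hφ⟩ := hK.2.1.exists_isDefiningFunctionAt hx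
  exact hφ.symmCurv_pos hK.1.1 hx (hK.2.2 x hx) hj

theorem isCompact_frontier : IsCompact (frontier K) :=
  hK.1.2.1.of_isClosed_subset isClosed_frontier hK.2.1.frontier_subset

variable (h0 : (0 : E n) ∈ interior K) (m k : ℕ) (i : ℕ → ℕ)

theorem aePosBounded_gaussCurv : AEPosBounded (weightMeasure m k i K) (gaussCurv K) :=
  (AEPosBounded.of_continuousOn hK.isCompact_frontier isClosed_frontier.measurableSet
    (hK.2.1.continuousOn_symmCurv hK.1.1 le_rfl) hK.2.2).mono_ac weightMeasure_absolutelyContinuous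

include h0

theorem supp_pos (hx : x ∈ frontier K) : 0 < supp K x :=
  (hK.2.1.isOuterUnitNormal_gaussMap hK.1.1 hx).inner_pos h0

theorem aePosBounded_densQ : AEPosBounded (weightMeasure m k i K) (densQ K) :=
  (AEPosBounded.of_continuousOn hK.isCompact_frontier isClosed_frontier.measurableSet
    (hK.2.1.continuousOn_supp hK.1.1) fun _ => hK.supp_pos h0).mono_ac
      weightMeasure_absolutelyContinuous

theorem aePosBounded_densP : AEPosBounded (weightMeasure m k i K) (densP K) :=
  (hK.aePosBounded_gaussCurv m k i).div ((hK.aePosBounded_densQ h0 m k i).pow n)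

theorem aePosBounded_weight :
    AEPosBounded ((μHE[n - 1] : Measure (E n)).restrict (frontier K)) fun x =>
      (∏ j ∈ Finset.Icc 1 (n - 1), ((n - 1).choose j : ℝ) ^ i j) *
        supp K x ^ ((m : ℤ) - (k : ℤ)) * ∏ j ∈ Finset.Icc 1 (n - 1), symmCurv K j x ^ i j := by
  refine AEPosBounded.of_continuousOn hK.isCompact_frontier isClosed_frontier.measurableSet
    ((continuousOn_const.mul ?_).mul ?_)
    fun x hx => mul_pos (mul_pos (Finset.prod_pos fun j hj => pow_pos ?_ _)
      (zpow_pos (hK.supp_pos h0 hx) _)) (Finset.prod_pos fun j hj => pow_pos ?_ _)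
  · exact (hK.2.1.continuousOn_supp hK.1.1).zpow₀ _ fun x hx => Or.inl (hK.supp_pos h0 hx).ne'
  · exact continuousOn_finsetProd _ fun j hj =>
      (hK.2.1.continuousOn_symmCurv hK.1.1 (Finset.mem_Icc.mp hj).2).pow _
  · exact_mod_cast Nat.choose_pos (Finset.mem_Icc.mp hj).2
  · exact hK.symmCurv_pos hx (Finset.mem_Icc.mp hj).2

theorem isFiniteMeasure_weightMeasure : IsFiniteMeasure (weightMeasure m k i K) := by
  have : IsFiniteMeasure ((μHE[n - 1] : Measure (E n)).restrict (frontier K)) :=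
    ⟨by simpa using hK.euclideanHausdorffMeasure_frontier_lt_top⟩
  exact isFiniteMeasure_withDensity_ofReal (hK.aePosBounded_weight h0 m k i).integrable.2

theorem neZero_weightMeasure (hn : 1 ≤ n) : NeZero (weightMeasure m k i K) := by
  have hweight := hK.aePosBounded_weight h0 m k i
  refine ⟨fun hzero => (hK.euclideanHausdorffMeasure_frontier_pos hn).ne' ?_⟩
  rw [← Measure.restrict_eq_zero, ← ae_eq_bot, ← eventually_false_iff_eq_bot]
  filter_upwards [withDensity_eq_zero hweight.aemeasurable.ennreal_ofReal hzero, hweight.ae_pos]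
    with x hx hpos using (ENNReal.ofReal_pos.mpr hpos).ne' hx

end IsC2PlusBody

end SurfaceMeasure

section LagrangeMultiplier

variable {F : Type*} [NormedAddCommGroup F] [InnerProductSpace ℝ F] [FiniteDimensional ℝ F]
  {φ : F → ℝ} {x : F} {t : ℝ}

/-- The map of the Lagrange multiplier rule: the critical points `a` of a linear functional
`⟪z, ·⟫` on the level set `φ = 0`, with multiplier `t`, are the solutions of
`lagrangeMap φ (a, t) = (z, 0)`. -/
noncomputable def lagrangeMap (φ : F → ℝ) (p : F × ℝ) : F × ℝ := (p.2 • ∇ φ p.1, φ p.1)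

theorem contDiffAt_lagrangeMap (hφ : ContDiffAt ℝ 2 φ x) (t : ℝ) :
    ContDiffAt ℝ 1 (lagrangeMap φ) (x, t) :=
  (contDiffAt_snd.smul ((contDiffAt_gradient hφ).comp (x, t) contDiffAt_fst)).prodMk
    ((hφ.of_le (by norm_num)).comp (x, t) contDiffAt_fst)

theorem fderiv_lagrangeMap_apply (hφ : ContDiffAt ℝ 2 φ x) (t : ℝ) (p : F × ℝ) :
    fderiv ℝ (lagrangeMap φ) (x, t) p =
      (t • fderiv ℝ (∇ φ) x p.1 + p.2 • ∇ φ x, fderiv ℝ φ x p.1) := by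
  have hgrad : HasFDerivAt (∇ φ ∘ Prod.fst) _ (x, t) :=
    (differentiableAt_gradient hφ).hasFDerivAt.comp (x, t) hasFDerivAt_fst
  have hval : HasFDerivAt (φ ∘ Prod.fst) _ (x, t) :=
    (hφ.differentiableAt two_ne_zero).hasFDerivAt.comp (x, t) hasFDerivAt_fst
  have h : HasFDerivAt (lagrangeMap φ) _ (x, t) := (hasFDerivAt_snd.smul hgrad).prodMk hval
  rw [h.fderiv]
  simp

variable (hφ : ContDiffAt ℝ 2 φ x) (hx : fderiv ℝ φ x ≠ 0)
  (hess : HasNondegenerateTangentHessian φ x) (ht : t ≠ 0)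

include hφ hx hess ht

theorem injective_fderiv_lagrangeMap : Function.Injective (fderiv ℝ (lagrangeMap φ) (x, t)) := by
  refine (injective_iff_map_eq_zero _).mpr fun p hp => ?_
  rw [fderiv_lagrangeMap_apply hφ, Prod.mk_eq_zero] at hp
  have hker : p.1 = 0 := hess p.1 hp.2 fun w hw => by
    have h := congrArg (⟪·, w⟫) hp.1
    simpa [inner_add_left, real_inner_smul_left, inner_fderiv_gradient hφ, hw, ht] using h
  have hmult : p.2 = 0 := by simpa [hker, gradient_ne_zero hx] using hp.1
  exact Prod.ext hker hmult

theorem exists_localInverse_lagrangeMap (hx0 : φ x = 0) :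
    ∃ X : F → F, ContDiffAt ℝ 1 X (t • ∇ φ x) ∧
      (∀ᶠ p : F × ℝ in 𝓝 (x, t), φ p.1 = 0 → X (p.2 • ∇ φ p.1) = p.1) ∧
      ∀ v, fderiv ℝ φ x (fderiv ℝ X (t • ∇ φ x) v) = 0 ∧
        ∃ s : ℝ, t • fderiv ℝ (∇ φ) x (fderiv ℝ X (t • ∇ φ x) v) + s • ∇ φ x = v := by
  let e : (F × ℝ) ≃L[ℝ] (F × ℝ) := (LinearEquiv.ofInjectiveEndo
    (fderiv ℝ (lagrangeMap φ) (x, t) : F × ℝ →ₗ[ℝ] F × ℝ)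
      (injective_fderiv_lagrangeMap hφ hx hess ht)).toContinuousLinearEquiv
  have hsmooth := contDiffAt_lagrangeMap hφ t
  have hderiv : HasFDerivAt (lagrangeMap φ) (e : F × ℝ →L[ℝ] F × ℝ) (x, t) :=
    (hsmooth.differentiableAt one_ne_zero).hasFDerivAt
  have hstrict := hsmooth.hasStrictFDerivAt' hderiv one_ne_zero
  have hval : lagrangeMap φ (x, t) = (t • ∇ φ x, 0) := by rw [lagrangeMap, hx0]
  let G := hsmooth.localInverse hderiv one_ne_zero
  have hG : ContDiffAt ℝ 1 G (t • ∇ φ x, 0) := hval ▸ hsmooth.to_localInverse hderiv one_ne_zero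
  have hG' : HasFDerivAt G (e.symm : F × ℝ →L[ℝ] F × ℝ) (t • ∇ φ x, 0) :=
    hval ▸ hstrict.to_localInverse.hasFDerivAt
  have hslice : HasFDerivAt (G ∘ fun z => (z, (0 : ℝ))) _ (t • ∇ φ x) :=
    hG'.comp (t • ∇ φ x) (hasFDerivAt_prodMk_left _ 0)
  have hX' : HasFDerivAt (fun z => (G (z, 0)).1) _ (t • ∇ φ x) := hslice.fst
  refine ⟨fun z => (G (z, 0)).1,
    (hG.comp (t • ∇ φ x) (contDiffAt_id.prodMk contDiffAt_const)).fst, ?_, fun v => ?_⟩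
  · filter_upwards [hstrict.eventually_left_inverse] with p hp hp0
    have hp' : G (p.2 • ∇ φ p.1, φ p.1) = p := hp
    rw [← hp0, hp']
  · have hv := (fderiv_lagrangeMap_apply hφ t (e.symm (v, 0))).symm.trans
      (e.apply_symm_apply (v, 0))
    rw [hX'.fderiv]
    exact ⟨congrArg Prod.snd hv, (e.symm (v, 0)).2, congrArg Prod.fst hv⟩

end LagrangeMultiplier

section SupportFunction

variable {F : Type*} [NormedAddCommGroup F] [InnerProductSpace ℝ F] {K : Set F} {x y z : F}
  {X : F → F}

/-- The support function `h_K`; it has the junk value `0` where `⟪y, ·⟫` is unbounded on `K`. -/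
noncomputable def supportFun (K : Set F) (y : F) : ℝ := sSup ((fun x => ⟪y, x⟫) '' K)

/-- `x` is a point of `K` at which the linear functional `⟪y, ·⟫` attains its maximum over `K`. -/
def IsSupportPoint (K : Set F) (y x : F) : Prop := x ∈ K ∧ ∀ a ∈ K, ⟪y, a⟫ ≤ ⟪y, x⟫

theorem exists_isSupportPoint (hK : IsCompact K) (hne : K.Nonempty) (y : F) :
    ∃ x, IsSupportPoint K y x :=
  hK.exists_isMaxOn hne (f := (⟪y, ·⟫)) (by fun_prop)

theorem IsSupportPoint.supportFun_eq (h : IsSupportPoint K y x) : supportFun K y = ⟪y, x⟫ :=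
  IsGreatest.csSup_eq ⟨Set.mem_image_of_mem _ h.1, Set.forall_mem_image.mpr h.2⟩

theorem IsSupportPoint.supportFun_pos (h : IsSupportPoint K y x) (h0 : (0 : F) ∈ interior K)
    (hy : y ≠ 0) : 0 < supportFun K y := by
  obtain ⟨t, ht, htK⟩ := exists_add_smul_mem_of_mem_interior h0 y
  rw [zero_add] at htK
  rw [h.supportFun_eq]
  refine lt_of_lt_of_le ?_ (h.2 _ htK)
  rw [real_inner_smul_right]
  exact mul_pos ht (real_inner_self_pos.mpr hy)

theorem eventually_forall_isSupportPoint_mem (hK : IsCompact K) (hx : IsSupportPoint K y x)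
    (huniq : ∀ a, IsSupportPoint K y a → a = x) {U : Set F} (hU : U ∈ 𝓝 x) :
    ∀ᶠ z in 𝓝 y, ∀ a, IsSupportPoint K z a → a ∈ U := by
  have hlt : ∀ a ∈ K \ interior U, ⟪y, a⟫ < ⟪y, x⟫ := fun a ha =>
    (hx.2 a ha.1).lt_of_ne fun heq =>
      ha.2 (huniq a ⟨ha.1, heq ▸ hx.2⟩ ▸ mem_interior_iff_mem_nhds.mpr hU)
  have hfar : ∀ᶠ z in 𝓝 y, ∀ a ∈ K \ interior U, ⟪z, a⟫ < ⟪z, x⟫ := by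
    refine (hK.diff isOpen_interior).eventually_forall_of_forall_eventually fun a ha => ?_
    have hl : Continuous fun p : F × F => ⟪p.1, p.2⟫ := by fun_prop
    have hr : Continuous fun p : F × F => ⟪p.1, x⟫ := by fun_prop
    exact hl.continuousAt.eventually_lt hr.continuousAt (hlt a ha)
  filter_upwards [hfar] with z hz a ha
  by_contra haU
  exact (hz a ⟨ha.1, fun hx_int => haU (interior_subset hx_int)⟩).not_ge (ha.2 x hx.1)

theorem hasGradientAt_supportFun [CompleteSpace F] (hX : ContinuousAt X y)
    (hmax : ∀ᶠ z in 𝓝 y, IsSupportPoint K z (X z)) :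
    HasGradientAt (supportFun K) (X y) y := by
  rw [hasGradientAt_iff_isLittleO, Asymptotics.isLittleO_iff]
  intro c hc
  have hclose := hX.eventually (Metric.ball_mem_nhds (X y) hc)
  filter_upwards [hmax, hclose] with z hz hzc
  have hy := hmax.self_of_nhds
  have hinner (w : F) : ⟪w, z - y⟫ = ⟪z, w⟫ - ⟪y, w⟫ := by rw [real_inner_comm, inner_sub_left]
  have hlower : 0 ≤ supportFun K z - supportFun K y - ⟪X y, z - y⟫ := by
    rw [hz.supportFun_eq, hy.supportFun_eq, hinner]
    linarith [hz.2 _ hy.1]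
  have hupper : supportFun K z - supportFun K y - ⟪X y, z - y⟫ ≤ ⟪X z - X y, z - y⟫ := by
    rw [hz.supportFun_eq, hy.supportFun_eq, inner_sub_left, hinner, hinner]
    linarith [hy.2 _ hz.1]
  rw [Real.norm_of_nonneg hlower]
  refine (hupper.trans (real_inner_le_norm _ _)).trans ?_
  gcongr
  exact (mem_ball_iff_norm.mp hzc).le

variable [CompleteSpace F] (hX : ContDiffAt ℝ 1 X y)
  (hmax : ∀ᶠ z in 𝓝 y, IsSupportPoint K z (X z))

include hX hmax

theorem eventually_hasGradientAt_supportFun :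
    ∀ᶠ z in 𝓝 y, HasGradientAt (supportFun K) (X z) z := by
  filter_upwards [hX.eventually (by simp), hmax.eventually_nhds] with z hz hmaxz
    using hasGradientAt_supportFun hz.continuousAt hmaxz

theorem contDiffAt_supportFun : ContDiffAt ℝ 2 (supportFun K) y := by
  refine contDiffAt_succ_iff_hasFDerivAt (n := 1).mpr ⟨fun z => InnerProductSpace.toDual ℝ F (X z),
    ⟨_, eventually_hasGradientAt_supportFun hX hmax, fun z hz => hz⟩,
    (InnerProductSpace.toDual ℝ F).contDiff.contDiffAt.comp y hX⟩

theorem fderiv_fderiv_supportFun (v w : F) :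
    fderiv ℝ (fderiv ℝ (supportFun K)) y v w = ⟪fderiv ℝ X y v, w⟫ := by
  have hgrad : ∇ (supportFun K) =ᶠ[𝓝 y] X := by
    filter_upwards [eventually_hasGradientAt_supportFun hX hmax] with z hz using hz.gradient
  rw [← inner_fderiv_gradient (contDiffAt_supportFun hX hmax), hgrad.fderiv_eq]

end SupportFunction

section SupportPoint

variable {n : ℕ} {K : Set (E n)} {φ : E n → ℝ} {x y : E n}

theorem convex_setOf_isSupportPoint (hK : Convex ℝ K) (y : E n) :
    Convex ℝ {x | IsSupportPoint K y x} := by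
  rintro a ha b hb s t hs ht hst
  refine ⟨hK ha.1 hb.1 hs ht hst, fun c hc => ?_⟩
  rw [inner_add_right, real_inner_smul_right, real_inner_smul_right]
  calc ⟪y, c⟫ = s * ⟪y, c⟫ + t * ⟪y, c⟫ := by rw [← add_mul, hst, one_mul]
    _ ≤ s * ⟪y, a⟫ + t * ⟪y, b⟫ := by
      gcongr
      exacts [ha.2 c hc, hb.2 c hc]

namespace IsSupportPoint

variable (h : IsSupportPoint K y x) (hy : y ≠ 0)

include h hy

theorem mem_frontier : x ∈ frontier K := by
  refine ⟨subset_closure h.1, fun hx_int => ?_⟩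
  obtain ⟨t, ht, htK⟩ := exists_add_smul_mem_of_mem_interior hx_int y
  have hle := h.2 _ htK
  rw [inner_add_right, real_inner_smul_right] at hle
  linarith [mul_pos ht (real_inner_self_pos.mpr hy)]

theorem isOuterUnitNormal : IsOuterUnitNormal K x (NormedSpace.normalize y) := by
  refine ⟨NormedSpace.norm_normalize_eq_one_iff.mpr hy, fun a ha => ?_⟩
  rw [NormedSpace.normalize, real_inner_smul_right, real_inner_comm, inner_sub_right]
  exact mul_nonpos_of_nonneg_of_nonpos (by positivity) (sub_nonpos.mpr (h.2 a ha))

theorem smul_gradient_eq (hφ : IsDefiningFunctionAt K φ x) :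
    (‖y‖ / ‖∇ φ x‖) • ∇ φ x = y := by
  rw [div_eq_mul_inv, mul_smul, ← NormedSpace.normalize,
    ← hφ.eq_normalize_gradient (h.mem_frontier hy) (h.isOuterUnitNormal hy),
    NormedSpace.norm_smul_normalize]

theorem exists_contDiffAt_eventually_eq (hφ : IsDefiningFunctionAt K φ x)
    (hess : HasNondegenerateTangentHessian φ x) :
    ∃ X : E n → E n, ContDiffAt ℝ 1 X y ∧
      (∀ᶠ p : E n × E n in 𝓝 (x, y), IsSupportPoint K p.2 p.1 → X p.2 = p.1) ∧
      ∀ v, ⟪y, fderiv ℝ X y v⟫ = 0 ∧ (fderiv ℝ X y v = 0 → v ∈ Submodule.span ℝ {y}) := by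
  have hg := norm_ne_zero_iff.mpr (gradient_ne_zero hφ.fderiv_ne_zero)
  have ht : ‖y‖ / ‖∇ φ x‖ ≠ 0 := div_ne_zero (norm_ne_zero_iff.mpr hy) hg
  have hsmul := h.smul_gradient_eq hy hφ
  obtain ⟨X, hX, hXeq, hX'⟩ := exists_localInverse_lagrangeMap hφ.contDiffAt hφ.fderiv_ne_zero
    hess ht (hφ.mem_frontier_iff.mp (h.mem_frontier hy))
  rw [hsmul] at hX hX'
  refine ⟨X, hX, ?_, fun v => ⟨?_, fun hv => ?_⟩⟩
  · have hgrad : ContinuousAt (∇ φ ∘ Prod.fst) (x, y) :=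
      (contDiffAt_gradient hφ.contDiffAt).continuousAt.comp continuousAt_fst
    have hcont : ContinuousAt (fun p : E n × E n => (p.1, ‖p.2‖ / ‖∇ φ p.1‖)) (x, y) :=
      continuousAt_fst.prodMk (continuousAt_snd.norm.div hgrad.norm hg)
    filter_upwards [hcont.eventually hXeq, continuousAt_fst.eventually hφ.eventually,
      continuousAt_snd.eventually_ne hy] with p hp hφp hp0 hsupp
    rw [← hp (hφp.mem_frontier_iff.mp (hsupp.mem_frontier hp0)), hsupp.smul_gradient_eq hp0 hφp]
  · calc ⟪y, fderiv ℝ X y v⟫ = ⟪(‖y‖ / ‖∇ φ x‖) • ∇ φ x, fderiv ℝ X y v⟫ := by rw [hsmul]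
      _ = 0 := by rw [real_inner_smul_left, inner_gradient_left, (hX' v).1, mul_zero]
  · obtain ⟨s, hs⟩ := (hX' v).2
    refine Submodule.mem_span_singleton.mpr ⟨s / (‖y‖ / ‖∇ φ x‖), ?_⟩
    nth_rw 2 [← hsmul]
    rw [smul_smul, div_mul_cancel₀ _ ht, ← hs, hv, map_zero, smul_zero, zero_add]

end IsSupportPoint

/- The support points for `y` form a convex set, so a locally unique one is unique; by compactness
the support points for nearby `z` are then close to it. -/
theorem exists_contDiffAt_eventually_isSupportPoint (hK : IsC2PlusBody K) (hy : y ≠ 0) :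
    ∃ X : E n → E n, ContDiffAt ℝ 1 X y ∧ (∀ᶠ z in 𝓝 y, IsSupportPoint K z (X z)) ∧
      ∀ v, ⟪y, fderiv ℝ X y v⟫ = 0 ∧ (fderiv ℝ X y v = 0 → v ∈ Submodule.span ℝ {y}) := by
  have hne : K.Nonempty := hK.1.2.2.mono interior_subset
  obtain ⟨x, hx⟩ := exists_isSupportPoint hK.1.2.1 hne y
  have hxK := hx.mem_frontier hy
  obtain ⟨φ, hφ⟩ := hK.2.1.exists_isDefiningFunctionAt hxK
  obtain ⟨X, hX, hXeq, hX'⟩ := hx.exists_contDiffAt_eventually_eq hy hφ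
    ((hφ.gaussCurv_pos_iff hK.1.1 hxK).mp (hK.2.2 x hxK))
  have huniq : ∀ a, IsSupportPoint K y a → a = x := fun a ha => by
    have htend : Tendsto (fun t : ℝ => (AffineMap.lineMap x a t, y)) (𝓝[>] 0) (𝓝 (x, y)) :=
      tendsto_nhdsWithin_of_tendsto_nhds
        (Continuous.tendsto' (by fun_prop) 0 _ (by rw [AffineMap.lineMap_apply_zero]))
    obtain ⟨t, hXt, ht⟩ :=
      ((htend.eventually hXeq).and (Ioc_mem_nhdsGT (zero_lt_one' ℝ))).exists
    have hsupp : IsSupportPoint K y (AffineMap.lineMap x a t) :=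
      (convex_setOf_isSupportPoint hK.1.1 y).lineMap_mem hx ha ⟨ht.1.le, ht.2⟩
    have heq : AffineMap.lineMap x a t = x := (hXt hsupp).symm.trans (hXeq.self_of_nhds hx)
    exact ((AffineMap.lineMap_eq_left_iff.mp heq).resolve_right ht.1.ne').symm
  obtain ⟨U, hU, V, hV, hUV⟩ := mem_nhds_prod_iff.mp hXeq
  refine ⟨X, hX, ?_, hX'⟩
  filter_upwards [hV, eventually_forall_isSupportPoint_mem hK.1.2.1 hx huniq hU] with z hzV hzU
  obtain ⟨a, ha⟩ := exists_isSupportPoint hK.1.2.1 hne z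
  have hXa : X z = a := hUV (Set.mk_mem_prod (hzU a ha) hzV) ha
  rwa [hXa]

end SupportPoint

section PolarBody

variable {n : ℕ} {K : Set (E n)} {y : E n} {X : E n → E n}

theorem convex_polarBody : Convex ℝ (polarBody K) := by
  rintro a ha b hb s t hs ht hst x hx
  rw [inner_add_left, real_inner_smul_left, real_inner_smul_left]
  calc s * ⟪a, x⟫ + t * ⟪b, x⟫ ≤ s * 1 + t * 1 := by
        gcongr
        exacts [ha x hx, hb x hx]
    _ = 1 := by rw [mul_one, mul_one, hst]

theorem isClosed_polarBody : IsClosed (polarBody K) := by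
  simp only [polarBody, Set.ofPred_forall]
  exact isClosed_biInter fun x _ => isClosed_le (by fun_prop) continuous_const

theorem isBounded_polarBody (h0 : (0 : E n) ∈ interior K) : Bornology.IsBounded (polarBody K) := by
  obtain ⟨r, hr, hball⟩ :=
    Metric.nhds_basis_closedBall.mem_iff.mp (mem_interior_iff_mem_nhds.mp h0)
  refine isBounded_iff_forall_norm_le.mpr ⟨1 / r, fun y hy => (le_div_iff₀ hr).mpr ?_⟩
  have hmem : r • NormedSpace.normalize y ∈ K := hball <| mem_closedBall_zero_iff.mpr <| by
    rw [norm_smul, Real.norm_of_nonneg hr.le, NormedSpace.normalize, norm_smul, norm_inv,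
      norm_norm]
    exact mul_le_of_le_one_right hr.le inv_mul_le_one
  calc ‖y‖ * r = ⟪y, r • NormedSpace.normalize y⟫ := by
        rw [real_inner_smul_right, NormedSpace.normalize, real_inner_smul_right,
          real_inner_self_eq_norm_sq, pow_two, ← mul_assoc ‖y‖⁻¹, inv_mul_mul_self, mul_comm]
    _ ≤ 1 := hy _ hmem

theorem zero_mem_interior_polarBody (hK : Bornology.IsBounded K) :
    (0 : E n) ∈ interior (polarBody K) := by
  obtain ⟨R, hR, hKR⟩ := hK.exists_pos_norm_le
  have hball : Metric.ball (0 : E n) R⁻¹ ∈ 𝓝 0 := Metric.ball_mem_nhds 0 (inv_pos.mpr hR)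
  refine mem_interior_iff_mem_nhds.mpr (mem_of_superset hball fun y hy x hx => ?_)
  calc ⟪y, x⟫ ≤ ‖y‖ * ‖x‖ := real_inner_le_norm y x
    _ ≤ R⁻¹ * R := by
      gcongr
      exacts [(mem_ball_zero_iff.mp hy).le, hKR x hx]
    _ = 1 := inv_mul_cancel₀ hR.ne'

theorem mem_polarBody_iff_supportFun_le_one (hK : IsCompact K) (hne : K.Nonempty) :
    y ∈ polarBody K ↔ supportFun K y ≤ 1 := by
  obtain ⟨x, hx⟩ := exists_isSupportPoint hK hne y
  rw [hx.supportFun_eq]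
  exact ⟨fun h => h x hx.1, fun h a ha => (hx.2 a ha).trans h⟩

section Regularity

variable (hX : ContDiffAt ℝ 1 X y) (hmax : ∀ᶠ z in 𝓝 y, IsSupportPoint K z (X z))
  (hpos : 0 < supportFun K y)

include hX hmax hpos

theorem isDefiningFunctionAt_polarBody (hK : IsCompact K) :
    IsDefiningFunctionAt (polarBody K) (fun z => supportFun K z - 1) y where
  contDiffAt := (contDiffAt_supportFun hX hmax).sub contDiffAt_const
  fderiv_ne_zero h := by
    have hgrad := (eventually_hasGradientAt_supportFun hX hmax).self_of_nhds.hasFDerivAt.fderiv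
    rw [fderiv_sub_const, hgrad, map_eq_zero_iff _ (InnerProductSpace.toDual ℝ (E n)).injective]
      at h
    rw [hmax.self_of_nhds.supportFun_eq, h, inner_zero_right] at hpos
    exact hpos.false
  eventually_mem_iff := Eventually.of_forall fun z => by
    rw [mem_polarBody_iff_supportFun_le_one hK ⟨_, hmax.self_of_nhds.1⟩, sub_nonpos]

theorem hasNondegenerateTangentHessian_supportFun
    (hX' : ∀ v, ⟪y, fderiv ℝ X y v⟫ = 0 ∧ (fderiv ℝ X y v = 0 → v ∈ Submodule.span ℝ {y})) :
    HasNondegenerateTangentHessian (fun z => supportFun K z - 1) y := by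
  have hgrad := (eventually_hasGradientAt_supportFun hX hmax).self_of_nhds.hasFDerivAt.fderiv
  have hsub : fderiv ℝ (fun z => supportFun K z - 1) = fderiv ℝ (supportFun K) :=
    funext fun z => fderiv_sub_const 1
  rw [hmax.self_of_nhds.supportFun_eq] at hpos
  intro v hv hess
  simp only [hsub, fderiv_fderiv_supportFun hX hmax, hgrad,
    InnerProductSpace.toDual_apply_apply] at hv hess
  have hspan : fderiv ℝ X y v ∈ Submodule.span ℝ {X y} := by
    rw [← (Submodule.span ℝ {X y}).orthogonal_orthogonal, Submodule.mem_orthogonal']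
    exact fun w hw => hess w (Submodule.mem_orthogonal_singleton_iff_inner_right.mp hw)
  have hzero : fderiv ℝ X y v = 0 := by
    obtain ⟨c, hc⟩ := Submodule.mem_span_singleton.mp hspan
    have horth := (hX' v).1
    rw [← hc, real_inner_smul_right, mul_eq_zero, or_iff_left hpos.ne'] at horth
    rw [← hc, horth, zero_smul]
  obtain ⟨s, rfl⟩ := Submodule.mem_span_singleton.mp ((hX' v).2 hzero)
  rw [real_inner_smul_right, real_inner_comm, mul_eq_zero, or_iff_left hpos.ne'] at hv
  rw [hv, zero_smul]

end Regularity

theorem IsC2PlusBody.polarBody (hK : IsC2PlusBody K) (h0 : (0 : E n) ∈ interior K) :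
    IsC2PlusBody (polarBody K) := by
  have h0' := zero_mem_interior_polarBody hK.1.2.1.isBounded
  have hdef : ∀ y ∈ frontier (WeightedAffineSurface.polarBody K),
      IsDefiningFunctionAt (WeightedAffineSurface.polarBody K) (fun z => supportFun K z - 1) y ∧
        HasNondegenerateTangentHessian (fun z => supportFun K z - 1) y := fun y hy => by
    have hy0 : y ≠ 0 := fun h => hy.2 (h ▸ h0')
    obtain ⟨X, hX, hmax, hX'⟩ := exists_contDiffAt_eventually_isSupportPoint hK hy0
    have hpos := hmax.self_of_nhds.supportFun_pos h0 hy0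
    exact ⟨isDefiningFunctionAt_polarBody hX hmax hpos hK.1.2.1,
      hasNondegenerateTangentHessian_supportFun hX hmax hpos hX'⟩
  refine ⟨⟨convex_polarBody, Metric.isCompact_of_isClosed_isBounded isClosed_polarBody
    (isBounded_polarBody h0), ⟨0, h0'⟩⟩, fun y hy => ?_, fun y hy => ?_⟩
  · exact ⟨_, (hdef y hy).1.contDiffAt, (hdef y hy).1.fderiv_ne_zero,
      (hdef y hy).1.eventually_mem_iff⟩
  · exact ((hdef y hy).1.gaussCurv_pos_iff convex_polarBody hy).mpr (hdef y hy).2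

end PolarBody

section Centroid

theorem setAverage_id_mem_interior {V : Type*} [NormedAddCommGroup V] [NormedSpace ℝ V]
    [FiniteDimensional ℝ V] [MeasurableSpace V] [BorelSpace V] (μ : Measure V)
    [μ.IsAddHaarMeasure] {K : Set V} (hK : Convex ℝ K) (hcomp : IsCompact K)
    (hne : (interior K).Nonempty) : ⨍ x in K, x ∂μ ∈ interior K := by
  by_contra hc
  obtain ⟨f, hf⟩ := geometric_hahn_banach_open_point hK.interior isOpen_interior hc
  have hid : IntegrableOn (fun x => x) (interior K) μ :=
    (continuousOn_id.integrableOn_compact hcomp).mono_set interior_subset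
  have hfin : μ (interior K) ≠ ⊤ :=
    ((measure_mono interior_subset).trans_lt hcomp.measure_lt_top).ne
  obtain ⟨x, hx, hle⟩ := exists_setAverage_le (isOpen_interior.measure_pos μ hne).ne' hfin
    (f.integrable_comp hid)
  have hcomm : ⨍ x in interior K, f x ∂μ = f (⨍ x in K, x ∂μ) := by
    rw [← setAverage_congr (interior_ae_eq_of_null_frontier (hK.addHaar_frontier μ)),
      setAverage_eq, setAverage_eq, f.integral_comp_comm hid, map_smul]
  exact (hf x hx).not_ge (hcomm ▸ hle)

theorem IsConvexBody.zero_mem_interior {n : ℕ} {K : Set (E n)} (hK : IsConvexBody K)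
    (hcentroid : (volume.real K)⁻¹ • (∫ x in K, x) = 0) : (0 : E n) ∈ interior K := by
  rw [← hcentroid, ← setAverage_eq]
  exact setAverage_id_mem_interior volume hK.1 hK.2.1 hK.2.2

end Centroid

end WeightedAffineSurface

theorem theorem3p8_general {n : ℕ} (hn : 1 ≤ n) (m k : ℕ) (i : ℕ → ℕ)
    {K : Set (EuclideanSpace ℝ (Fin n))} (hK : IsC2PlusBody K) (h0 : 0 ∈ interior K) :
    (Integrable (klIntegrand (densP K) (densQ K)) (weightMeasure m k i K) ∧
      Tendsto (fun p : ℝ => (omega m k i p K / omegaInfty m k i K) ^ ((n : ℝ) + p)) atTop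
        (𝓝 (Real.exp (-((n : ℝ) * klDivergence (weightMeasure m k i K) (densP K) (densQ K) /
          omegaInfty m k i K))))) ∧
    (Integrable (klIntegrand (densQ (polarBody K)) (densP (polarBody K)))
        (weightMeasure m k i (polarBody K)) ∧
      Tendsto (fun p : ℝ => (omega m k i p (polarBody K) / omega m k i 0 (polarBody K)) ^
          ((n : ℝ) * ((n : ℝ) + p) / p)) (𝓝[≠] 0)
        (𝓝 (Real.exp (-((n : ℝ) * klDivergence (weightMeasure m k i (polarBody K))
          (densQ (polarBody K)) (densP (polarBody K)) / omega m k i 0 (polarBody K)))))) := by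
  have hK' := hK.polarBody h0
  have h0' := zero_mem_interior_polarBody hK.1.2.1.isBounded
  have := hK.isFiniteMeasure_weightMeasure h0 m k i
  have := hK.neZero_weightMeasure h0 m k i hn
  have := hK'.isFiniteMeasure_weightMeasure h0' m k i
  have := hK'.neZero_weightMeasure h0' m k i hn
  have hP := hK.aePosBounded_densP h0 m k i
  have hQ := hK.aePosBounded_densQ h0 m k i
  have hP' := hK'.aePosBounded_densP h0' m k i
  have hQ' := hK'.aePosBounded_densQ h0' m k i
  exact ⟨⟨hP.integrable_klIntegrand hQ, tendsto_omega_div_omegaInfty_rpow hP hQ hn⟩,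
    hQ'.integrable_klIntegrand hP', tendsto_omega_div_omega_zero_rpow hP' hQ' hn⟩

theorem theorem3p8 (n : ℕ) (hn : 1 ≤ n) (m k : ℕ) (i : ℕ → ℕ)
    (hi : ∑ j ∈ Finset.Icc 1 (n - 1), j * i j = m)
    (K : Set (EuclideanSpace ℝ (Fin n))) (hK : IsC2PlusBody K)
    (hcentroid : (volume.real K)⁻¹ • (∫ x in K, x) = 0) :
    (Integrable (klIntegrand (densP K) (densQ K)) (weightMeasure m k i K) ∧
      Tendsto (fun p : ℝ => (omega m k i p K / omegaInfty m k i K) ^ ((n : ℝ) + p)) atTop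
        (𝓝 (Real.exp (-((n : ℝ) * klDivergence (weightMeasure m k i K) (densP K) (densQ K) /
          omegaInfty m k i K))))) ∧
    (Integrable (klIntegrand (densQ (polarBody K)) (densP (polarBody K)))
        (weightMeasure m k i (polarBody K)) ∧
      Tendsto (fun p : ℝ => (omega m k i p (polarBody K) / omega m k i 0 (polarBody K)) ^
          ((n : ℝ) * ((n : ℝ) + p) / p)) (𝓝[≠] 0)
        (𝓝 (Real.exp (-((n : ℝ) * klDivergence (weightMeasure m k i (polarBody K))
          (densQ (polarBody K)) (densP (polarBody K)) / omega m k i 0 (polarBody K)))))) :=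
  theorem3p8_general hn m k i hK (hK.1.zero_mem_interior hcentroid)
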